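/- Let $d\ge 1$, $\mathbb T^d=(\mathbb R/2\pi\mathbb Z)^d$ with Lebesgue measure $dp$ (total mass $(2\pi)^d$), and let $\omega:\mathbb T^d\to\mathbb R$ be continuous with $\min\omega=a\ge 0$ and $\max\omega=1$, both values being taken only on sets of measure zero. For real $(\mu,\nu)\neq(0,0)$ with $\mu\omega+\nu\ge 0$ on $\mathbb T^d$, let $$B_{\mu,\nu}(p)=\frac{1}{e^{\mu\omega(p)+\nu}-1};$$ if $B_{\mu,\nu}$ is integrable, it is called a Bose–Einstein equilibrium, with mass $\mathcal M(B_{\mu,\nu})=\int_{\mathbb T^d} B_{\mu,\nu}\,dp$ and energy $\mathcal E(B_{\mu,\nu})=\int_{\mathbb T^d}\omega B_{\mu,\nu}\,dp$. Uniqueness of an equilibrium below means uniqueness of the pair $(\mu,\nu)$. Put $$\alpha=a+(2\pi)^d\Big(\int_{\mathbb T^d}\frac{dp}{\omega-a}\Big)^{-1},\qquad \beta=1-(2\pi)^d\Big(\int_{\mathbb T^d}\frac{dp}{1-\omega}\Big)^{-1}.$$ (i) If $\int\frac{dp}{\omega-a}=\int\frac{dp}{1-\omega}=\infty$, then for all real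 $\mathcal M_0,\mathcal E_0$ with $a\mathcal M_0<\mathcal E_0<\mathcal M_0$ there is a unique Bose–Einstein equilibrium with mass $\mathcal M_0$ and energy $\mathcal E_0$. (ii) If $\int\frac{dp}{\omega-a}<\infty$ and $\int\frac{dp}{1-\omega}<\infty$, then for every $t>0$ the functions $B_{-t,t}$ and $B_{t,-at}$ are Bose–Einstein equilibria, and the curves $$\mathcal C_+=\{(\mathcal M(B_{-t,t}),\mathcal E(B_{-t,t})):t>0\},\qquad \mathcal C_-=\{(\mathcal M(B_{t,-at}),\mathcal E(B_{t,-at})):t>0\}$$ are graphs $\mathcal C_\pm=\{(\mathcal M,f_\pm(\mathcal M)):\mathcal M\in(0,\infty)\}$ of functions $f_\pm$ that are differentiable and strictly increasing on $[0,\infty)$ (one-sided derivative at $0$), with $f_+(0)=f_-(0)=0$ and $$\lim_{\mathcal M\to\infty}\frac{f_+(\mathcal M)}{\mathcal M}=\beta,\qquad \lim_{\mathcal M\to\infty}\frac{f_-(\mathcal M)}{\mathcal M}=\alpha.$$ Let $S=\{(\mathcal M,\mathcal E):\mathcal M>0,\ f_-(\mathcal M)\le\mathcal E\le f_+(\mathcal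 M)\}$. For all real $\mathcal M_0,\mathcal E_0$, there is a Bose–Einstein equilibrium with mass $\mathcal M_0$ and energy $\mathcal E_0$ if and only if $(\mathcal M_0,\mathcal E_0)\in S$, and it is then unique. -/

import Mathlib

open MeasureTheory Filter Topology Set
open scoped Real ENNReal

instance factTwoPiPos : Fact ((0 : ℝ) < 2 * π) := ⟨Real.two_pi_pos⟩

/-- The torus `(ℝ / 2πℤ)^d`; its `volume` is Lebesgue measure `dp`, of total mass `(2π)^d`. -/
abbrev Torus (d : ℕ) : Type := Fin d → AddCircle (2 * π)

namespace BoseEinstein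

noncomputable section

variable {d : ℕ}

/-- The mass `∫ f dp`. -/
def mass (f : Torus d → ℝ) : ℝ := ∫ p, f p

/-- The energy `∫ ω f dp`. -/
def energy (ω f : Torus d → ℝ) : ℝ := ∫ p, ω p * f p

/-- The function `B_{μ,ν}(p) = 1 / (e^{μ ω(p) + ν} - 1)`. -/
def B (ω : Torus d → ℝ) (μ ν : ℝ) (p : Torus d) : ℝ :=
  1 / (Real.exp (μ * ω p + ν) - 1)

/-- `B_{μ,ν}` is a Bose–Einstein equilibrium: `(μ, ν) ≠ (0, 0)` (for `(0, 0)` the formula reads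
`1 / 0` everywhere), `B_{μ,ν}` takes values in `[0, ∞]`, i.e. the exponent is nonnegative,
and `B_{μ,ν}` is integrable. -/
structure IsEquilibrium (ω : Torus d → ℝ) (μ ν : ℝ) : Prop where
  ne_zero : (μ, ν) ≠ (0, 0)
  nonneg : ∀ p, 0 ≤ μ * ω p + ν
  integrable : Integrable (B ω μ ν)

/-- The parameters `(μ, ν)` of the Bose–Einstein equilibria of mass `M₀` and energy `E₀`. -/
def equilibria (ω : Torus d → ℝ) (M₀ E₀ : ℝ) : Set (ℝ × ℝ) :=
  {q | IsEquilibrium ω q.1 q.2 ∧ mass (B ω q.1 q.2) = M₀ ∧ energy ω (B ω q.1 q.2) = E₀}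

/-- `∫ dp / (ω - a)` as an element of `[0, ∞]`. -/
def lowerIntegral (ω : Torus d → ℝ) (a : ℝ) : ℝ≥0∞ := ∫⁻ p, (ENNReal.ofReal (ω p - a))⁻¹

/-- `∫ dp / (1 - ω)` as an element of `[0, ∞]`. -/
def upperIntegral (ω : Torus d → ℝ) : ℝ≥0∞ := ∫⁻ p, (ENNReal.ofReal (1 - ω p))⁻¹

/-- `α = a + (2π)^d (∫ dp / (ω - a))⁻¹`. -/
def alpha (ω : Torus d → ℝ) (a : ℝ) : ℝ := a + (2 * π) ^ d * ((lowerIntegral ω a)⁻¹).toReal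

/-- `β = 1 - (2π)^d (∫ dp / (1 - ω))⁻¹`. -/
def beta (ω : Torus d → ℝ) : ℝ := 1 - (2 * π) ^ d * ((upperIntegral ω)⁻¹).toReal

/-- The curve of the pairs (mass, energy) of `B_{μ,ν}` with `(μ, ν) = (-t, t)`, `t > 0`. -/
def curvePlus (ω : Torus d → ℝ) : Set (ℝ × ℝ) :=
  {x | ∃ t : ℝ, 0 < t ∧ x = (mass (B ω (-t) t), energy ω (B ω (-t) t))}

/-- The curve of the pairs (mass, energy) of `B_{μ,ν}` with `(μ, ν) = (t, -a t)`, `t > 0`. -/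
def curveMinus (ω : Torus d → ℝ) (a : ℝ) : Set (ℝ × ℝ) :=
  {x | ∃ t : ℝ, 0 < t ∧ x = (mass (B ω t (-a * t)), energy ω (B ω t (-a * t)))}

/-- The graph of `f` over `(0, ∞)`. -/
def graphPos (f : ℝ → ℝ) : Set (ℝ × ℝ) := {x | 0 < x.1 ∧ x.2 = f x.1}

/-- The region over `(0, ∞)` between the graphs of `fm` (below) and `fp` (above), graphs
included. -/
def regionS (fm fp : ℝ → ℝ) : Set (ℝ × ℝ) := {x | 0 < x.1 ∧ fm x.1 ≤ x.2 ∧ x.2 ≤ fp x.1}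

end

end BoseEinstein

/-! A nonzero exponent `μ ω + ν` that is nonnegative on the torus is `t > 0` times a convex
combination `mix` of `1 - ω` and `ω - a` with parameter `θ ∈ [0, 1]`. The ends `θ = 0` and `θ = 1`
give the two boundary curves.

Uniqueness is strict monotonicity. For two exponents `h`, `h'` the integral of `(h - h') (planck h'
- planck h)` is nonnegative and vanishes only if `h = h'`; it is also a linear combination of the
differences of mass and energy (`moments_monotone`). At equal mass, together with a pointwise
comparison of exponents, this makes the boundary curves carry the extreme energies, so no
equilibrium lies outside `S`.

Existence is a continuity argument at fixed mass. For each admissible `θ` the mass decreases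
strictly in `t` through all positive values, so one `T θ` gives the mass `M`; the energy is then
continuous in `θ`, and the intermediate value theorem applies. If both integrals are finite, `θ` may
run over `[0, 1]`, with ends on the boundary curves. If they are infinite, Fatou's lemma makes the
mass at fixed `t` blow up near each end; so `T θ` is large there, and the energy comes close to `M`
or `a M` (`exists_forall_integral_lt`).

Along a boundary curve mass and energy both have negative derivative in `t`, which gives an
increasing graph. Its slope at `0` comes from concentration where the exponent vanishes (`t → ∞`),
its asymptotic slope from `t planck (t g) → 1 / g` (`t → 0`). -/

namespace BoseEinstein

/-! ### Elementary bounds for the Planck function -/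

/-- The Planck function `1 / (e^u - 1)`. -/
noncomputable def planck (u : ℝ) : ℝ := 1 / (Real.exp u - 1)

lemma exp_sub_one_pos {u : ℝ} (hu : 0 < u) : 0 < Real.exp u - 1 :=
  sub_pos.2 (Real.one_lt_exp_iff.2 hu)

lemma planck_pos {u : ℝ} (hu : 0 < u) : 0 < planck u :=
  one_div_pos.2 (exp_sub_one_pos hu)

lemma strictAntiOn_planck : StrictAntiOn planck (Ioi 0) := by
  intro u hu u' _ h
  exact one_div_lt_one_div_of_lt (exp_sub_one_pos hu)
    (sub_lt_sub_right (Real.exp_lt_exp.2 h) 1)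

lemma planck_le_inv {u : ℝ} (hu : 0 < u) : planck u ≤ u⁻¹ := by
  rw [planck, one_div]
  exact inv_anti₀ hu (by linarith [Real.add_one_le_exp u])

/-- After multiplication by `e^u - 1` this is `1 - e^{-u} ≤ u`. With `planck_le_inv` it makes
`planck u` comparable to `1 / u` on bounded ranges of `u > 0`. -/
lemma exp_neg_mul_inv_le_planck {u : ℝ} (hu : 0 < u) : Real.exp (-u) * u⁻¹ ≤ planck u := by
  rw [planck, le_div_iff₀ (exp_sub_one_pos hu)]
  have h1 : Real.exp (-u) * Real.exp u = 1 := by rw [← Real.exp_add]; simp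
  have h2 : Real.exp (-u) * u⁻¹ * (Real.exp u - 1) = (1 - Real.exp (-u)) * u⁻¹ := by
    linear_combination u⁻¹ * h1
  rw [h2, ← div_eq_mul_inv, div_le_one hu]
  linarith [Real.add_one_le_exp (-u)]

lemma planck_two_mul_le {u : ℝ} (hu : 0 < u) : planck (2 * u) ≤ Real.exp (-u) * planck u := by
  have h := exp_sub_one_pos hu
  have h1 : Real.exp (-u) * Real.exp u = 1 := by rw [← Real.exp_add]; simp
  have h2 : Real.exp (2 * u) = Real.exp u * Real.exp u := by rw [← Real.exp_add]; ring_nf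
  rw [planck, planck, mul_one_div, div_le_div_iff₀ (exp_sub_one_pos (by linarith)) h, h2]
  nlinarith [Real.exp_pos (-u)]

lemma hasDerivAt_planck {u : ℝ} (hu : 0 < u) :
    HasDerivAt planck (-(planck u + planck u ^ 2)) u := by
  have h := (exp_sub_one_pos hu).ne'
  have := (((Real.hasDerivAt_exp u).sub_const 1).inv h)
  have h2 : planck = (fun x => Real.exp x - 1)⁻¹ := by
    ext x; simp [planck]
  rw [h2]
  refine this.congr_deriv ?_
  simp only [Pi.inv_apply]
  field_simp
  ring

lemma continuousAt_planck {u : ℝ} (hu : 0 < u) : ContinuousAt planck u :=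
  (hasDerivAt_planck hu).continuousAt

@[fun_prop]
lemma measurable_planck : Measurable planck := by
  unfold planck; fun_prop

/-! ### Moments of `planck (t g)` for one profile `g` -/

variable {X : Type*} [MeasurableSpace X] {v : Measure X}

lemma integral_pos_of_ae_pos [NeZero v] {f : X → ℝ} (hf : Integrable f v)
    (h : ∀ᵐ p ∂v, 0 < f p) : 0 < ∫ p, f p ∂v := by
  rw [integral_pos_iff_support_of_nonneg_ae (h.mono fun _ hp => hp.le) hf]
  have : Function.support f =ᵐ[v] univ := by
    filter_upwards [h] with p hp
    exact eq_true (show f p ≠ 0 from hp.ne')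
  rw [measure_congr this]
  exact Measure.measure_univ_pos.2 (NeZero.ne v)

/-- A measurable function `g ≤ 1`, almost everywhere positive, with integrable inverse. -/
structure IsProfile (v : Measure X) (g : X → ℝ) : Prop where
  measurable : Measurable g
  pos : ∀ᵐ p ∂v, 0 < g p
  le_one : ∀ p, g p ≤ 1
  integrable_inv : Integrable (fun p => (g p)⁻¹) v

/-- The integral of `planck (t g)` with weight `w`. -/
noncomputable def moment (v : Measure X) (g w : X → ℝ) (t : ℝ) : ℝ :=
  ∫ p, w p * planck (t * g p) ∂v

variable {g w : X → ℝ} {C t : ℝ}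

namespace IsProfile

lemma integrable_moment (hg : IsProfile v g) (hw : Measurable w) (hC : ∀ p, |w p| ≤ C)
    (ht : 0 < t) : Integrable (fun p => w p * planck (t * g p)) v := by
  have hm := hg.measurable
  refine Integrable.bdd_mul (c := C) ?_ hw.aestronglyMeasurable (ae_of_all _ hC)
  refine (hg.integrable_inv.const_mul t⁻¹).mono'
    (measurable_planck.comp (hm.const_mul t)).aestronglyMeasurable ?_
  filter_upwards [hg.pos] with p hp
  have := mul_pos ht hp
  rw [Real.norm_of_nonneg (planck_pos this).le, ← mul_inv]
  exact planck_le_inv this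

lemma integrable_planck (hg : IsProfile v g) (ht : 0 < t) :
    Integrable (fun p => planck (t * g p)) v := by
  simpa using hg.integrable_moment (w := fun _ => 1) (C := 1) measurable_const (by simp) ht

/-- The derivative of `planck` may grow like `u⁻²` at `0`, but the factor `g` from the chain rule
absorbs one power: for `x > t / 2` a multiple of `1 + g⁻¹` (depending on `t`) dominates, so
integrability of `g⁻¹` suffices. -/
lemma hasDerivAt_moment (hg : IsProfile v g) [IsFiniteMeasure v] (hw : Measurable w)
    (hC : ∀ p, |w p| ≤ C) (ht : 0 < t) :
    Integrable (fun p => w p * (-(planck (t * g p) + planck (t * g p) ^ 2) * g p)) v ∧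
    HasDerivAt (moment v g w)
      (∫ p, w p * (-(planck (t * g p) + planck (t * g p) ^ 2) * g p) ∂v) t := by
  have hm := hg.measurable
  have hpos : ∀ x ∈ Ioi (t / 2), 0 < x := fun x hx => (half_pos ht).trans hx
  refine hasDerivAt_integral_of_dominated_loc_of_deriv_le
    (F' := fun x p => w p * (-(planck (x * g p) + planck (x * g p) ^ 2) * g p))
    (bound := fun p => C * (2 / t + (2 / t) ^ 2 * (g p)⁻¹)) (s := Ioi (t / 2))
    (Ioi_mem_nhds (half_lt_self ht)) (Eventually.of_forall fun x => by fun_prop)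
    (hg.integrable_moment hw hC ht) (by fun_prop) ?_
    (((integrable_const _).add (hg.integrable_inv.const_mul _)).const_mul _) ?_
  · filter_upwards [hg.pos] with p hp x hx
    have hx0 := hpos x hx
    have hxg := mul_pos hx0 hp
    have h1 := planck_le_inv hxg
    have h0 := planck_pos hxg
    have hx2 : x⁻¹ ≤ 2 / t := by
      rw [← inv_div]; exact inv_anti₀ (half_pos ht) (le_of_lt hx)
    rw [Real.norm_eq_abs, abs_mul]
    refine mul_le_mul (hC p) ?_ (abs_nonneg _) ((abs_nonneg _).trans (hC p))
    rw [neg_mul, abs_neg, abs_of_nonneg (by positivity)]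
    calc (planck (x * g p) + planck (x * g p) ^ 2) * g p
        ≤ ((x * g p)⁻¹ + (x * g p)⁻¹ ^ 2) * g p := by gcongr
      _ = x⁻¹ + x⁻¹ ^ 2 * (g p)⁻¹ := by field_simp
      _ ≤ _ := by gcongr
  · filter_upwards [hg.pos] with p hp x hx
    have hxg := mul_pos (hpos x hx) hp
    have h1 : HasDerivAt (fun x => x * g p) (g p) x := by
      simpa using (hasDerivAt_id x).mul_const (g p)
    exact ((hasDerivAt_planck hxg).comp x h1).const_mul (w p)

lemma deriv_moment_neg (hg : IsProfile v g) [IsFiniteMeasure v] [NeZero v] (hw : Measurable w)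
    (hC : ∀ p, |w p| ≤ C) (hw0 : ∀ᵐ p ∂v, 0 < w p) (ht : 0 < t) :
    ∫ p, w p * (-(planck (t * g p) + planck (t * g p) ^ 2) * g p) ∂v < 0 := by
  rw [← neg_pos, ← integral_neg]
  refine integral_pos_of_ae_pos (hg.hasDerivAt_moment hw hC ht).1.neg ?_
  filter_upwards [hw0, hg.pos] with p h1 h2
  have := planck_pos (mul_pos ht h2)
  rw [neg_mul, mul_neg, neg_neg]
  positivity

lemma moment_pos (hg : IsProfile v g) [NeZero v] (hw : Measurable w)
    (hC : ∀ p, |w p| ≤ C) (hw0 : ∀ᵐ p ∂v, 0 < w p) (ht : 0 < t) : 0 < moment v g w t := by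
  refine integral_pos_of_ae_pos (hg.integrable_moment hw hC ht) ?_
  filter_upwards [hw0, hg.pos] with p h1 h2
  exact mul_pos h1 (planck_pos (mul_pos ht h2))

lemma strictAntiOn_moment (hg : IsProfile v g) [IsFiniteMeasure v] [NeZero v] (hw : Measurable w)
    (hC : ∀ p, |w p| ≤ C) (hw0 : ∀ᵐ p ∂v, 0 < w p) : StrictAntiOn (moment v g w) (Ioi 0) := by
  refine strictAntiOn_of_deriv_neg (convex_Ioi 0) (fun t ht =>
    (hg.hasDerivAt_moment hw hC ht).2.continuousAt.continuousWithinAt) fun t ht => ?_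
  rw [interior_Ioi] at ht
  rw [(hg.hasDerivAt_moment hw hC ht).2.deriv]
  exact hg.deriv_moment_neg hw hC hw0 ht

lemma exists_integral_planck_eq (hg : IsProfile v g) [IsFiniteMeasure v] [NeZero v] {M : ℝ}
    (hM : 0 < M) : ∃ t, 0 < t ∧ ∫ p, planck (t * g p) ∂v = M := by
  have hV : 0 < v.real univ := measureReal_univ_pos
  have hI : 0 < ∫ p, (g p)⁻¹ ∂v :=
    integral_pos_of_ae_pos hg.integrable_inv (hg.pos.mono fun p hp => inv_pos.2 hp)
  have hcont : ContinuousOn (fun t => ∫ p, planck (t * g p) ∂v) (Ioi 0) := by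
    intro t ht
    have := (hg.hasDerivAt_moment (w := fun _ => 1) (C := 1) measurable_const (by simp)
      ht).2.continuousAt
    unfold moment at this
    simp only [one_mul] at this
    exact this.continuousWithinAt
  -- Since `g ≤ 1`, the mass at `t ≤ 1` is at least `v(X) e⁻¹ / t`, which dictates `t₁`. Since
  -- `planck u ≤ 1 / u`, it is at most `(∫ g⁻¹) / t`, which dictates `t₂`. The `1` in `t₂` only
  -- ensures `t₁ ≤ t₂`.
  set t₁ := min 1 (v.real univ * Real.exp (-1) / M) with ht₁
  set t₂ := max 1 ((∫ p, (g p)⁻¹ ∂v) / M) with ht₂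
  have h1 : 0 < t₁ := lt_min one_pos (by positivity)
  have h12 : t₁ ≤ t₂ := (min_le_left _ _).trans (le_max_left _ _)
  have h2 : 0 < t₂ := h1.trans_le h12
  have hup : M ≤ ∫ p, planck (t₁ * g p) ∂v := by
    have hb : M / v.real univ ≤ planck t₁ := by
      refine le_trans ?_ (exp_neg_mul_inv_le_planck h1)
      have e1 : Real.exp (-1) ≤ Real.exp (-t₁) :=
        Real.exp_le_exp.2 (neg_le_neg (min_le_left _ _))
      have e2 : t₁ ≤ v.real univ * Real.exp (-1) / M := min_le_right _ _
      rw [← div_eq_mul_inv, div_le_div_iff₀ hV h1]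
      rw [le_div_iff₀ hM] at e2
      nlinarith
    calc M = ∫ _, M / v.real univ ∂v := by
          rw [integral_const, smul_eq_mul]; field_simp
      _ ≤ _ := by
        refine integral_mono_ae (integrable_const _) (hg.integrable_planck h1) ?_
        filter_upwards [hg.pos] with p hp
        exact hb.trans (strictAntiOn_planck.antitoneOn (mul_pos h1 hp) h1
          (mul_le_of_le_one_right h1.le (hg.le_one p)))
  have hdown : ∫ p, planck (t₂ * g p) ∂v ≤ M := by
    calc ∫ p, planck (t₂ * g p) ∂v ≤ ∫ p, t₂⁻¹ * (g p)⁻¹ ∂v := by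
          refine integral_mono_ae (hg.integrable_planck h2) (hg.integrable_inv.const_mul _) ?_
          filter_upwards [hg.pos] with p hp
          rw [← mul_inv]
          exact planck_le_inv (mul_pos h2 hp)
      _ = t₂⁻¹ * ∫ p, (g p)⁻¹ ∂v := integral_const_mul _ _
      _ ≤ M := by
        have e2 : (∫ p, (g p)⁻¹ ∂v) / M ≤ t₂ := le_max_right _ _
        rw [div_le_iff₀ hM] at e2
        rw [inv_mul_le_iff₀ h2]
        exact e2
  obtain ⟨t, ht, he⟩ := intermediate_value_Icc' h12
    (hcont.mono fun t ht => h1.trans_le ht.1) ⟨hdown, hup⟩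
  exact ⟨t, h1.trans_le ht.1, he⟩

/-- Dominated convergence: `t planck (t g)` is squeezed between `e^{-t g} / g` and `1 / g`. -/
lemma tendsto_mul_moment (hg : IsProfile v g) (hw : Measurable w) (hC : ∀ p, |w p| ≤ C) :
    Tendsto (fun t => t * moment v g w t) (𝓝[>] 0) (𝓝 (∫ p, w p * (g p)⁻¹ ∂v)) := by
  have hm := hg.measurable
  simp only [moment, ← integral_const_mul]
  have hup : ∀ p, 0 < g p → ∀ t, 0 < t → t * planck (t * g p) ≤ (g p)⁻¹ := by
    intro p hp t ht
    have := mul_le_mul_of_nonneg_left (planck_le_inv (mul_pos ht hp)) ht.le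
    rwa [mul_inv, mul_inv_cancel_left₀ ht.ne'] at this
  refine tendsto_integral_filter_of_dominated_convergence (fun p => C * (g p)⁻¹)
    (Eventually.of_forall fun t => by fun_prop) ?_ (hg.integrable_inv.const_mul C) ?_
  · filter_upwards [self_mem_nhdsWithin] with t ht
    filter_upwards [hg.pos] with p hp
    have h0 : 0 ≤ t * planck (t * g p) :=
      mul_nonneg (le_of_lt ht) (planck_pos (mul_pos ht hp)).le
    rw [mul_left_comm, Real.norm_eq_abs, abs_mul, abs_of_nonneg h0]
    exact mul_le_mul (hC p) (hup p hp t ht) h0 ((abs_nonneg _).trans (hC p))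
  · filter_upwards [hg.pos] with p hp
    simp_rw [mul_left_comm _ (w p)]
    refine Tendsto.const_mul _ ?_
    have hlow : Tendsto (fun t => Real.exp (-(t * g p)) * (g p)⁻¹) (𝓝[>] 0) (𝓝 (g p)⁻¹) := by
      have : Continuous fun t => Real.exp (-(t * g p)) * (g p)⁻¹ := by fun_prop
      simpa using (this.tendsto 0).mono_left nhdsWithin_le_nhds
    refine tendsto_of_tendsto_of_tendsto_of_le_of_le' hlow tendsto_const_nhds ?_ ?_
    · filter_upwards [self_mem_nhdsWithin] with t ht
      have := mul_le_mul_of_nonneg_left (exp_neg_mul_inv_le_planck (mul_pos ht hp)) (le_of_lt ht)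
      rwa [mul_inv, mul_left_comm, mul_inv_cancel_left₀ (ne_of_gt ht)] at this
    · filter_upwards [self_mem_nhdsWithin] with t ht using hup p hp t ht

lemma abs_le_one (hg : IsProfile v g) (h0 : ∀ p, 0 ≤ g p) (p : X) : |g p| ≤ 1 :=
  (abs_of_nonneg (h0 p)).trans_le (hg.le_one p)

/-- As `t → ∞`, the function `planck (t g)` concentrates where `g` is small. -/
lemma tendsto_moment_self_div (hg : IsProfile v g) [IsFiniteMeasure v] [NeZero v]
    (h0 : ∀ p, 0 ≤ g p) (hsmall : ∀ ε, 0 < ε → 0 < v {p | g p < ε}) :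
    Tendsto (fun t => moment v g g t / ∫ p, planck (t * g p) ∂v) atTop (𝓝 0) := by
  have hm := hg.measurable
  have habs := hg.abs_le_one h0
  rw [Metric.tendsto_nhds]
  intro ε hε
  -- The integral is split at the level `g = 2 η`. Below it, `g ≤ 2 η` costs `2 η` times the mass.
  -- Above it, `planck (2 t η)` is exponentially smaller than `planck (t η)`, which the set `{g <
  -- η}` of positive measure bounds by a multiple of the mass; this costs less than another `2 η`
  -- for large `t`.
  obtain ⟨η, hη, hηε⟩ : ∃ η, 0 < η ∧ 2 * (2 * η) = ε := ⟨ε / 4, by positivity, by ring⟩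
  have hδ : 0 < v.real {p | g p < η} :=
    ENNReal.toReal_pos (hsmall η hη).ne' (measure_ne_top _ _)
  have hlim : Tendsto (fun t => v.real univ / v.real {p | g p < η} * Real.exp (-(t * η)))
      atTop (𝓝 0) := by
    have : Tendsto (fun t : ℝ => Real.exp (-(t * η))) atTop (𝓝 0) :=
      Real.tendsto_exp_neg_atTop_nhds_zero.comp (tendsto_id.atTop_mul_const hη)
    simpa using this.const_mul (v.real univ / v.real {p | g p < η})
  filter_upwards [hlim.eventually (gt_mem_nhds (show 0 < 2 * η by positivity)),
    eventually_gt_atTop 0] with t hsm ht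
  have hMpos : 0 < ∫ p, planck (t * g p) ∂v := by
    simpa [moment] using hg.moment_pos (w := fun _ => 1) (C := 1) measurable_const (by simp)
      (ae_of_all _ fun _ => one_pos) ht
  have hGnonneg : 0 ≤ moment v g g t := (hg.moment_pos hm habs hg.pos ht).le
  have hG : moment v g g t ≤
      2 * η * (∫ p, planck (t * g p) ∂v) + v.real univ * planck (t * (2 * η)) := by
    have : ∫ p, (2 * η * planck (t * g p) + planck (t * (2 * η))) ∂v =
        2 * η * (∫ p, planck (t * g p) ∂v) + v.real univ * planck (t * (2 * η)) := by
      rw [integral_add ((hg.integrable_planck ht).const_mul _) (integrable_const _),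
        integral_const_mul, integral_const, smul_eq_mul]
    rw [← this]
    refine integral_mono_ae (hg.integrable_moment hm habs ht)
      (((hg.integrable_planck ht).const_mul _).add (integrable_const _)) ?_
    filter_upwards [hg.pos] with p hp
    have e1 := planck_pos (mul_pos ht hp)
    have e2 : 0 < planck (t * (2 * η)) := planck_pos (by positivity)
    rcases le_total (g p) (2 * η) with h | h
    · have := mul_le_mul_of_nonneg_right h e1.le
      linarith
    · have e3 : planck (t * g p) ≤ planck (t * (2 * η)) :=
        strictAntiOn_planck.antitoneOn (show 0 < t * (2 * η) by positivity) (mul_pos ht hp)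
          (mul_le_mul_of_nonneg_left h ht.le)
      have e4 := mul_le_of_le_one_left e1.le (hg.le_one p)
      have e5 : 0 < 2 * η * planck (t * g p) := by positivity
      linarith
  have hM : v.real {p | g p < η} * planck (t * η) ≤ ∫ p, planck (t * g p) ∂v := by
    have hms : MeasurableSet {p | g p < η} := measurableSet_lt hm measurable_const
    calc v.real {p | g p < η} * planck (t * η) = ∫ p in {p | g p < η}, planck (t * η) ∂v := by
          rw [setIntegral_const, smul_eq_mul]
      _ ≤ ∫ p in {p | g p < η}, planck (t * g p) ∂v := by
        refine setIntegral_mono_on_ae (integrable_const _).integrableOn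
          (hg.integrable_planck ht).integrableOn hms ?_
        filter_upwards [hg.pos] with p hp hpη
        exact strictAntiOn_planck.antitoneOn (mul_pos ht hp) (mul_pos ht hη)
          (mul_le_mul_of_nonneg_left (le_of_lt hpη) ht.le)
      _ ≤ _ := by
        refine setIntegral_le_integral (hg.integrable_planck ht) ?_
        filter_upwards [hg.pos] with p hp using (planck_pos (mul_pos ht hp)).le
  have hp2 : planck (t * (2 * η)) ≤ Real.exp (-(t * η)) * planck (t * η) := by
    rw [mul_left_comm]
    exact planck_two_mul_le (mul_pos ht hη)
  have hkey : v.real univ * planck (t * (2 * η)) < 2 * η * ∫ p, planck (t * g p) ∂v := by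
    have e0 := planck_pos (mul_pos ht hη)
    calc v.real univ * planck (t * (2 * η))
        ≤ v.real univ * (Real.exp (-(t * η)) * planck (t * η)) := by gcongr
      _ = v.real univ / v.real {p | g p < η} * Real.exp (-(t * η)) *
          (v.real {p | g p < η} * planck (t * η)) := by field_simp
      _ < 2 * η * (v.real {p | g p < η} * planck (t * η)) := by gcongr
      _ ≤ _ := by gcongr
  rw [Real.dist_eq, sub_zero, abs_of_nonneg (div_nonneg hGnonneg hMpos.le), div_lt_iff₀ hMpos,
    ← hηε]
  linarith

end IsProfile

end BoseEinstein

/-! ### Implicit functions and curves with decreasing coordinates -/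

namespace BoseEinstein

/-- An implicit function given by a strictly decreasing equation is continuous. -/
lemma continuousOn_of_strictAntiOn {Y : Type*} [TopologicalSpace Y] {F : ℝ → Y → ℝ} {s : Set Y}
    {T : Y → ℝ} {m : Y → ℝ} (hanti : ∀ y ∈ s, StrictAntiOn (fun t => F t y) (Ioi 0))
    (hcont : ∀ t, 0 < t → ContinuousOn (F t) s) (hm : ContinuousOn m s)
    (hT : ∀ y ∈ s, 0 < T y) (hFT : ∀ y ∈ s, F (T y) y = m y) : ContinuousOn T s := by
  intro y hy
  refine tendsto_order.2 ⟨fun l hl => ?_, fun u hu => ?_⟩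
  -- For `l > 0`, strict decrease turns `l < T y` into `m y < F l y`, which persists near `y`
  -- because `l` is fixed; decrease then turns it back into `l < T z`.
  · rcases le_or_gt l 0 with h | h
    · filter_upwards [self_mem_nhdsWithin] with z hz using h.trans_lt (hT z hz)
    · have h1 : m y < F l y := by
        rw [← hFT y hy]; exact hanti y hy h (hT y hy) hl
      filter_upwards [self_mem_nhdsWithin, (hm y hy).eventually_lt (hcont l h y hy) h1] with z hz h2
      rw [← hFT z hz] at h2
      exact ((hanti z hz).lt_iff_gt (hT z hz) h).1 h2
  · have h := (hT y hy).trans hu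
    have h1 : F u y < m y := by
      rw [← hFT y hy]; exact hanti y hy (hT y hy) h hu
    filter_upwards [self_mem_nhdsWithin, (hcont u h y hy).eventually_lt (hm y hy) h1] with z hz h2
    rw [← hFT z hz] at h2
    exact ((hanti z hz).lt_iff_gt h (hT z hz)).1 h2

/-- A curve whose two coordinates are decreasing and whose first coordinate runs over `(0, ∞)` is
the graph of an increasing function. -/
lemma exists_graph_of_curve {M E M' E' : ℝ → ℝ} {c l : ℝ}
    (hM : ∀ t, 0 < t → HasDerivAt M (M' t) t) (hM' : ∀ t, 0 < t → M' t < 0)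
    (hE : ∀ t, 0 < t → HasDerivAt E (E' t) t) (hE' : ∀ t, 0 < t → E' t < 0)
    (hMpos : ∀ t, 0 < t → 0 < M t) (hEpos : ∀ t, 0 < t → 0 < E t)
    (hsurj : ∀ m, 0 < m → ∃ t, 0 < t ∧ M t = m)
    (hc : Tendsto (fun t => E t / M t) atTop (𝓝 c))
    (hl : Tendsto (fun t => E t / M t) (𝓝[>] 0) (𝓝 l)) :
    ∃ f : ℝ → ℝ, {x : ℝ × ℝ | ∃ t : ℝ, 0 < t ∧ x = (M t, E t)} = graphPos f ∧
      DifferentiableOn ℝ f (Ici 0) ∧ StrictMonoOn f (Ici 0) ∧ f 0 = 0 ∧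
      Tendsto (fun m => f m / m) atTop (𝓝 l) := by
  choose! T hT hMT using hsurj
  have anti : ∀ {g g' : ℝ → ℝ}, (∀ t, 0 < t → HasDerivAt g (g' t) t) → (∀ t, 0 < t → g' t < 0) →
      StrictAntiOn g (Ioi 0) := by
    intro g g' hg hg'
    refine strictAntiOn_of_deriv_neg (convex_Ioi 0)
      (fun t ht => (hg t ht).continuousAt.continuousWithinAt) fun t ht => ?_
    rw [interior_Ioi] at ht
    rw [(hg t ht).deriv]
    exact hg' t ht
  have hMa := anti hM hM'
  have hEa := anti hE hE'
  have hTM : ∀ t, 0 < t → T (M t) = t := fun t ht =>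
    hMa.injOn (hT _ (hMpos t ht)) ht (hMT _ (hMpos t ht))
  have hTa : StrictAntiOn T (Ioi 0) := by
    intro x hx y hy hxy
    rw [← hMa.lt_iff_gt (hT x hx) (hT y hy), hMT x hx, hMT y hy]
    exact hxy
  have hTcont : ContinuousOn T (Ioi 0) :=
    continuousOn_of_strictAntiOn (F := fun t _ => M t) (m := id) (fun _ _ => hMa)
      (fun _ _ => continuousOn_const) continuousOn_id hT hMT
  have hTatTop : Tendsto T (𝓝[>] 0) atTop := by
    refine tendsto_atTop.2 fun R => ?_
    have hR : 0 < max R 1 := lt_max_of_lt_right one_pos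
    filter_upwards [Ioo_mem_nhdsGT (hMpos _ hR)] with m hm
    have := hTa hm.1 (hMpos _ hR) hm.2
    rw [hTM _ hR] at this
    exact (le_max_left _ _).trans this.le
  have hTzero : Tendsto T atTop (𝓝[>] 0) := by
    refine tendsto_nhdsWithin_iff.2 ⟨tendsto_order.2 ⟨fun b hb => ?_, fun b hb => ?_⟩, ?_⟩
    · filter_upwards [eventually_gt_atTop 0] with m hm using hb.trans (hT m hm)
    · filter_upwards [eventually_gt_atTop (M b)] with m hm
      have := hTa (hMpos b hb) ((hMpos b hb).trans hm) hm
      rwa [hTM b hb] at this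
    · filter_upwards [eventually_gt_atTop 0] with m hm using hT m hm
  set f : ℝ → ℝ := fun m => if 0 < m then E (T m) else 0 with hf
  have hfpos : ∀ m, 0 < m → f m = E (T m) := fun m hm => if_pos hm
  have hf0 : f 0 = 0 := if_neg (lt_irrefl _)
  have hratio : ∀ m, 0 < m → E (T m) / M (T m) = f m / m := fun m hm => by
    rw [hMT m hm, hfpos m hm]
  refine ⟨f, ?_, ?_, ?_, hf0, ?_⟩
  · ext ⟨x, y⟩
    constructor
    · rintro ⟨t, ht, h⟩
      obtain ⟨rfl, rfl⟩ := Prod.mk.inj h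
      exact ⟨hMpos t ht, by simp only [hfpos _ (hMpos t ht), hTM t ht]⟩
    · rintro ⟨hx, hy⟩
      simp only at hx hy
      exact ⟨T x, hT x hx, by rw [hMT x hx, hy, hfpos x hx]⟩
  · intro m hm
    rcases (mem_Ici.1 hm).eq_or_lt with rfl | hm
    -- The difference quotient of `f` at `0` is `E / M` evaluated at `T m`, and `T m → ∞` as `m →
    -- 0`.
    · refine HasDerivWithinAt.differentiableWithinAt (f' := c) ?_
      rw [← hasDerivWithinAt_Ioi_iff_Ici,
        hasDerivWithinAt_iff_tendsto_slope' self_notMem_Ioi]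
      refine (hc.comp hTatTop).congr' ?_
      filter_upwards [self_mem_nhdsWithin] with m hm
      rw [Function.comp_apply, hratio m hm, slope_def_field, hf0, sub_zero, sub_zero]
    · refine DifferentiableAt.differentiableWithinAt ?_
      have h1 : HasDerivAt T (M' (T m))⁻¹ m := by
        refine HasDerivAt.of_local_left_inverse (hTcont.continuousAt (Ioi_mem_nhds hm))
          (hM _ (hT m hm)) (hM' _ (hT m hm)).ne ?_
        filter_upwards [Ioi_mem_nhds hm] with x hx using hMT x hx
      have h2 := (hE _ (hT m hm)).comp m h1
      refine (h2.congr_of_eventuallyEq ?_).differentiableAt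
      filter_upwards [Ioi_mem_nhds hm] with x hx using hfpos x hx
  · intro x hx y _ hxy
    have hy : 0 < y := (mem_Ici.1 hx).trans_lt hxy
    rw [hfpos y hy]
    rcases (mem_Ici.1 hx).eq_or_lt with rfl | hx
    · rw [hf0]; exact hEpos _ (hT y hy)
    · rw [hfpos x hx]
      exact hEa (hT y hy) (hT x hx) (hTa hx hy hxy)
  · refine (hl.comp hTzero).congr' ?_
    filter_upwards [eventually_gt_atTop 0] with m hm using hratio m hm

end BoseEinstein

/-! ### Mixtures of two profiles at fixed mass -/

namespace BoseEinstein

/-- The function interpolating linearly between `g₁` at `θ = 0` and `g₂` at `θ = 1`. -/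
def mix {X : Type*} (g₁ g₂ : X → ℝ) (θ : ℝ) (p : X) : ℝ := (1 - θ) * g₁ p + θ * g₂ p

lemma mix_comm {X : Type*} {g₁ g₂ : X → ℝ} (θ : ℝ) : mix g₂ g₁ θ = mix g₁ g₂ (1 - θ) := by
  ext p; simp only [mix]; ring

lemma mix_zero {X : Type*} {g₁ g₂ : X → ℝ} : mix g₁ g₂ 0 = g₁ := by ext p; simp [mix]

lemma mix_one {X : Type*} {g₁ g₂ : X → ℝ} : mix g₁ g₂ 1 = g₂ := by ext p; simp [mix]

lemma min_le_mix {X : Type*} {g₁ g₂ : X → ℝ} {θ : ℝ} (hθ : θ ∈ Icc (0 : ℝ) 1) (p : X) :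
    min (g₁ p) (g₂ p) ≤ mix g₁ g₂ θ p := by
  have e1 := mul_le_mul_of_nonneg_left (min_le_left (g₁ p) (g₂ p)) (sub_nonneg.2 hθ.2)
  have e2 := mul_le_mul_of_nonneg_left (min_le_right (g₁ p) (g₂ p)) hθ.1
  simp only [mix]
  linarith

lemma continuous_mix {X : Type*} {g₁ g₂ : X → ℝ} (p : X) : Continuous fun θ => mix g₁ g₂ θ p := by
  unfold mix; fun_prop

variable {X : Type*} [MeasurableSpace X] {v : Measure X} {g g₁ g₂ w : X → ℝ} {C t κ : ℝ}

/-- The curve of masses and energies of `planck (t g)` is the graph of an increasing function. -/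
lemma IsProfile.exists_graph (hg : IsProfile v g) [IsFiniteMeasure v] [NeZero v]
    (h0 : ∀ p, 0 ≤ g p) (hsmall : ∀ ε, 0 < ε → 0 < v {p | g p < ε}) {c k : ℝ}
    (hwg : ∀ p, w p = c + k * g p) (hw0 : ∀ᵐ p ∂v, 0 < w p) :
    ∃ f : ℝ → ℝ, {x : ℝ × ℝ | ∃ t : ℝ, 0 < t ∧
        x = (∫ p, planck (t * g p) ∂v, ∫ p, w p * planck (t * g p) ∂v)} = graphPos f ∧
      DifferentiableOn ℝ f (Ici 0) ∧ StrictMonoOn f (Ici 0) ∧ f 0 = 0 ∧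
      Tendsto (fun m => f m / m) atTop (𝓝 (c + k * (v.real univ / ∫ p, (g p)⁻¹ ∂v))) := by
  have hm := hg.measurable
  have habs := hg.abs_le_one h0
  obtain rfl : w = fun p => c + k * g p := funext hwg
  have hw : Measurable fun p => c + k * g p := by fun_prop
  have hC : ∀ p, |c + k * g p| ≤ |c| + |k| := fun p => by
    refine (abs_add_le _ _).trans ?_
    rw [abs_mul]
    gcongr
    exact mul_le_of_le_one_right (abs_nonneg k) (habs p)
  have h1m : Measurable fun _ : X => (1 : ℝ) := measurable_const
  have h1C : ∀ _ : X, |(1 : ℝ)| ≤ 1 := by simp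
  have h10 : ∀ᵐ _ ∂v, (0 : ℝ) < 1 := ae_of_all _ fun _ => one_pos
  have hmass : ∀ t, moment v g (fun _ => 1) t = ∫ p, planck (t * g p) ∂v := fun t => by
    simp [moment]
  have hI : 0 < ∫ p, (g p)⁻¹ ∂v :=
    integral_pos_of_ae_pos hg.integrable_inv (hg.pos.mono fun p hp => inv_pos.2 hp)
  have hMpos : ∀ t, 0 < t → 0 < moment v g (fun _ => 1) t := fun t ht =>
    hg.moment_pos h1m h1C h10 ht
  -- The weight is affine in `g`, so both limits of energy over mass reduce to those of `moment v g
  -- g` over mass.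
  have hsplit : ∀ t, 0 < t → c + k * (moment v g g t / moment v g (fun _ => 1) t) =
      moment v g (fun p => c + k * g p) t / moment v g (fun _ => 1) t := fun t ht => by
    have : moment v g (fun p => c + k * g p) t =
        c * moment v g (fun _ => 1) t + k * moment v g g t := by
      rw [moment, hmass, moment, ← integral_const_mul, ← integral_const_mul, ← integral_add
        ((hg.integrable_planck ht).const_mul _) ((hg.integrable_moment hm habs ht).const_mul _)]
      exact integral_congr_ae (ae_of_all _ fun p => by ring)
    rw [this]
    have := (hMpos t ht).ne'
    field_simp
  have := exists_graph_of_curve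
    (fun t ht => (hg.hasDerivAt_moment h1m h1C ht).2) (fun t ht => hg.deriv_moment_neg h1m h1C h10 ht)
    (fun t ht => (hg.hasDerivAt_moment hw hC ht).2) (fun t ht => hg.deriv_moment_neg hw hC hw0 ht)
    hMpos (fun t ht => hg.moment_pos hw hC hw0 ht)
    (fun m hm => by simpa only [hmass] using hg.exists_integral_planck_eq hm)
    (c := c) (l := c + k * (v.real univ / ∫ p, (g p)⁻¹ ∂v)) ?_ ?_
  · simpa only [moment, one_mul] using this
  · have := ((hg.tendsto_moment_self_div h0 hsmall).const_mul k).const_add c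
    rw [mul_zero, add_zero] at this
    refine this.congr' ?_
    filter_upwards [eventually_gt_atTop 0] with t ht
    rw [← hmass, hsplit t ht]
  -- Numerator and denominator are both multiplied by `t`; their limits are `∫ g g⁻¹ = v(X)` and `∫
  -- g⁻¹`.
  · have e1 := hg.tendsto_mul_moment hm habs
    have e2 := hg.tendsto_mul_moment h1m h1C
    have e3 : ∫ p, g p * (g p)⁻¹ ∂v = v.real univ := by
      have : (fun p => g p * (g p)⁻¹) =ᵐ[v] fun _ => (1 : ℝ) := by
        filter_upwards [hg.pos] with p hp using mul_inv_cancel₀ hp.ne'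
      rw [integral_congr_ae this]
      simp
    simp only [one_mul] at e2
    rw [e3] at e1
    refine (((e1.div e2 hI.ne').const_mul k).const_add c).congr' ?_
    filter_upwards [self_mem_nhdsWithin] with t ht
    rw [← hsplit t ht, Pi.div_apply, mul_div_mul_left _ _ (ne_of_gt ht)]

/-- Dominated convergence with `planck h ≤ 1 / h ≤ 1 / m`; a single minorant `m` of the exponents
with integrable inverse is all that is needed. -/
lemma continuousOn_integral_planck {Y : Type*} [TopologicalSpace Y] [FirstCountableTopology Y]
    {s : Set Y} {h : Y → X → ℝ} {m : X → ℝ} (hw : Measurable w) (hC : ∀ p, |w p| ≤ C)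
    (hmeas : ∀ y ∈ s, Measurable (h y)) (hcont : ∀ p, ContinuousOn (fun y => h y p) s)
    (hmpos : ∀ᵐ p ∂v, 0 < m p) (hmint : Integrable (fun p => (m p)⁻¹) v)
    (hmh : ∀ y ∈ s, ∀ p, m p ≤ h y p) :
    ContinuousOn (fun y => ∫ p, w p * planck (h y p) ∂v) s := by
  refine continuousOn_of_dominated (bound := fun p => C * (m p)⁻¹) (fun y hy => ?_)
    (fun y hy => ?_) (hmint.const_mul C) ?_
  · exact (hw.mul (measurable_planck.comp (hmeas y hy))).aestronglyMeasurable
  · filter_upwards [hmpos] with p hp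
    have hh := hp.trans_le (hmh y hy p)
    rw [Real.norm_eq_abs, abs_mul, abs_of_pos (planck_pos hh)]
    refine mul_le_mul (hC p) ?_ (planck_pos hh).le ((abs_nonneg _).trans (hC p))
    exact (planck_le_inv hh).trans (inv_anti₀ hp (hmh y hy p))
  · filter_upwards [hmpos] with p hp
    refine continuousOn_const.mul fun y hy => ?_
    exact (continuousAt_planck (hp.trans_le (hmh y hy p))).tendsto.comp (hcont p y hy)

/-- In a family of profiles, the moments at fixed mass depend continuously on the profile. -/
lemma continuousOn_moment_of_mass_eq {Y : Type*} [TopologicalSpace Y] [FirstCountableTopology Y]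
    [IsFiniteMeasure v] [NeZero v] {s : Set Y} (hs : IsCompact s) {h : Y → X → ℝ} {m : X → ℝ}
    (hw : Measurable w) (hC : ∀ p, |w p| ≤ C) (hprof : ∀ y ∈ s, IsProfile v (h y))
    (hcont : ∀ p, ContinuousOn (fun y => h y p) s)
    (hmpos : ∀ᵐ p ∂v, 0 < m p) (hmint : Integrable (fun p => (m p)⁻¹) v)
    (hm0 : ∀ p, 0 ≤ m p) (hmh : ∀ y ∈ s, ∀ p, m p ≤ h y p) {T : Y → ℝ} {M : ℝ}
    (hT : ∀ y ∈ s, 0 < T y) (hTM : ∀ y ∈ s, ∫ p, planck (T y * h y p) ∂v = M) :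
    ContinuousOn (fun y => ∫ p, w p * planck (T y * h y p) ∂v) s := by
  rcases s.eq_empty_or_nonempty with rfl | hne
  · exact continuousOn_empty _
  have h1C : ∀ _ : X, |(1 : ℝ)| ≤ 1 := by simp
  have hdom : ∀ t : ℝ, 0 < t → (∀ᵐ p ∂v, 0 < t * m p) ∧
      Integrable (fun p => (t * m p)⁻¹) v := fun t ht =>
    ⟨hmpos.mono fun p hp => mul_pos ht hp, by simpa only [mul_inv] using hmint.const_mul t⁻¹⟩
  have hTc : ContinuousOn T s := by
    refine continuousOn_of_strictAntiOn (F := fun t y => moment v (h y) (fun _ => 1) t)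
      (m := fun _ => M) (fun y hy => (hprof y hy).strictAntiOn_moment measurable_const h1C
        (ae_of_all _ fun _ => one_pos)) (fun t ht => ?_) continuousOn_const hT
      (fun y hy => by simpa [moment] using hTM y hy)
    exact continuousOn_integral_planck (m := fun p => t * m p) measurable_const h1C
      (fun y hy => (hprof y hy).measurable.const_mul t)
      (fun p => continuousOn_const.mul (hcont p)) (hdom t ht).1 (hdom t ht).2
      (fun y hy p => mul_le_mul_of_nonneg_left (hmh y hy p) ht.le)
  -- By compactness `T` has a positive minimum `T z`, so `T z * m` is a common minorant of all
  -- exponents `T y * h y`.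
  obtain ⟨z, hz, hmin⟩ := hs.exists_isMinOn hne hTc
  exact continuousOn_integral_planck (m := fun p => T z * m p) hw hC
    (fun y hy => (hprof y hy).measurable.const_mul _) (fun p => hTc.mul (hcont p))
    (hdom _ (hT z hz)).1 (hdom _ (hT z hz)).2
    (fun y hy p => mul_le_mul (hmin hy) (hmh y hy p) (hm0 p) (hT y hy).le)

/-- Two nonnegative, almost everywhere positive functions of constant sum `κ ∈ (0, 1]`. -/
structure IsComplementary (v : Measure X) (g₁ g₂ : X → ℝ) (κ : ℝ) : Prop where
  measurable_left : Measurable g₁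
  measurable_right : Measurable g₂
  pos_left : ∀ᵐ p ∂v, 0 < g₁ p
  pos_right : ∀ᵐ p ∂v, 0 < g₂ p
  nonneg_left : ∀ p, 0 ≤ g₁ p
  nonneg_right : ∀ p, 0 ≤ g₂ p
  add_eq : ∀ p, g₁ p + g₂ p = κ
  pos : 0 < κ
  le_one : κ ≤ 1

namespace IsComplementary

lemma symm (h : IsComplementary v g₁ g₂ κ) : IsComplementary v g₂ g₁ κ where
  measurable_left := h.measurable_right
  measurable_right := h.measurable_left
  pos_left := h.pos_right
  pos_right := h.pos_left
  nonneg_left := h.nonneg_right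
  nonneg_right := h.nonneg_left
  add_eq p := by rw [add_comm, h.add_eq p]
  pos := h.pos
  le_one := h.le_one

lemma le_one_left (h : IsComplementary v g₁ g₂ κ) (p : X) : g₁ p ≤ 1 := by
  linarith [h.add_eq p, h.nonneg_right p, h.le_one]

lemma isProfile_left (h : IsComplementary v g₁ g₂ κ)
    (hint : Integrable (fun p => (g₁ p)⁻¹) v) : IsProfile v g₁ :=
  ⟨h.measurable_left, h.pos_left, h.le_one_left, hint⟩

lemma measurable_mix (h : IsComplementary v g₁ g₂ κ) (θ : ℝ) : Measurable (mix g₁ g₂ θ) :=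
  (h.measurable_left.const_mul _).add (h.measurable_right.const_mul _)

lemma mul_le_mix (h : IsComplementary v g₁ g₂ κ) {θ b : ℝ} (h1 : b ≤ θ) (h2 : b ≤ 1 - θ) (p : X) :
    b * κ ≤ mix g₁ g₂ θ p := by
  have e1 := mul_le_mul_of_nonneg_right h2 (h.nonneg_left p)
  have e2 := mul_le_mul_of_nonneg_right h1 (h.nonneg_right p)
  rw [← h.add_eq p, mul_add]
  exact add_le_add e1 e2

lemma mix_le_one (h : IsComplementary v g₁ g₂ κ) {θ : ℝ} (hθ : θ ∈ Icc (0 : ℝ) 1) (p : X) :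
    mix g₁ g₂ θ p ≤ 1 := by
  have e1 := mul_le_mul_of_nonneg_left (h.le_one_left p) (sub_nonneg.2 hθ.2)
  have e2 := mul_le_mul_of_nonneg_left (h.symm.le_one_left p) hθ.1
  simp only [mix]
  linarith

/-- In the open interval the mixture is at least `min θ (1 - θ) * κ > 0`, so its inverse is bounded
even if `1 / g₁` and `1 / g₂` are not integrable. -/
lemma isProfile_mix (h : IsComplementary v g₁ g₂ κ) [IsFiniteMeasure v] {θ : ℝ}
    (hθ : θ ∈ Ioo (0 : ℝ) 1) : IsProfile v (mix g₁ g₂ θ) := by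
  have hb : 0 < min θ (1 - θ) * κ := mul_pos (lt_min hθ.1 (sub_pos.2 hθ.2)) h.pos
  have hle := h.mul_le_mix (min_le_left θ (1 - θ)) (min_le_right θ (1 - θ))
  refine ⟨h.measurable_mix θ, ae_of_all _ fun p => hb.trans_le (hle p),
    h.mix_le_one (Ioo_subset_Icc_self hθ), ?_⟩
  refine (integrable_const (min θ (1 - θ) * κ)⁻¹).mono'
    (h.measurable_mix θ).inv.aestronglyMeasurable (ae_of_all _ fun p => ?_)
  rw [Real.norm_of_nonneg (inv_nonneg.2 (hb.trans_le (hle p)).le)]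
  exact inv_anti₀ hb (hle p)

lemma continuousOn_moment_Ioo (h : IsComplementary v g₁ g₂ κ) [IsFiniteMeasure v] [NeZero v]
    (hw : Measurable w) (hC : ∀ p, |w p| ≤ C) {θ₁ θ₂ : ℝ} (h1 : 0 < θ₁) (h2 : θ₂ < 1)
    {T : ℝ → ℝ} {M : ℝ} (hT : ∀ θ ∈ Icc θ₁ θ₂, 0 < T θ)
    (hTM : ∀ θ ∈ Icc θ₁ θ₂, ∫ p, planck (T θ * mix g₁ g₂ θ p) ∂v = M) :
    ContinuousOn (fun θ => ∫ p, w p * planck (T θ * mix g₁ g₂ θ p) ∂v) (Icc θ₁ θ₂) := by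
  have hb : 0 < min θ₁ (1 - θ₂) * κ := mul_pos (lt_min h1 (sub_pos.2 h2)) h.pos
  exact continuousOn_moment_of_mass_eq isCompact_Icc (m := fun _ => min θ₁ (1 - θ₂) * κ) hw hC
    (fun θ hθ => h.isProfile_mix ⟨h1.trans_le hθ.1, hθ.2.trans_lt h2⟩)
    (fun p => (continuous_mix p).continuousOn) (ae_of_all _ fun _ => hb) (integrable_const _)
    (fun _ => hb.le) (fun θ hθ p => h.mul_le_mix ((min_le_left _ _).trans hθ.1)
      ((min_le_right _ _).trans (sub_le_sub_left hθ.2 1)) p) hT hTM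

lemma isProfile_mix_Icc (h : IsComplementary v g₁ g₂ κ) [IsFiniteMeasure v]
    (hi₁ : Integrable (fun p => (g₁ p)⁻¹) v) (hi₂ : Integrable (fun p => (g₂ p)⁻¹) v) {θ : ℝ}
    (hθ : θ ∈ Icc (0 : ℝ) 1) : IsProfile v (mix g₁ g₂ θ) := by
  rcases hθ.1.eq_or_lt with rfl | h1
  · rw [mix_zero]; exact h.isProfile_left hi₁
  rcases hθ.2.eq_or_lt with rfl | h2
  · rw [mix_one]; exact h.symm.isProfile_left hi₂
  exact h.isProfile_mix ⟨h1, h2⟩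

/-- Up to the ends the constant minorant is lost; `min g₁ g₂` replaces it, its inverse being at most
`1 / g₁ + 1 / g₂`. -/
lemma continuousOn_moment_Icc (h : IsComplementary v g₁ g₂ κ) [IsFiniteMeasure v] [NeZero v]
    (hw : Measurable w) (hC : ∀ p, |w p| ≤ C)
    (hi₁ : Integrable (fun p => (g₁ p)⁻¹) v) (hi₂ : Integrable (fun p => (g₂ p)⁻¹) v)
    {T : ℝ → ℝ} {M : ℝ} (hT : ∀ θ ∈ Icc (0 : ℝ) 1, 0 < T θ)
    (hTM : ∀ θ ∈ Icc (0 : ℝ) 1, ∫ p, planck (T θ * mix g₁ g₂ θ p) ∂v = M) :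
    ContinuousOn (fun θ => ∫ p, w p * planck (T θ * mix g₁ g₂ θ p) ∂v) (Icc 0 1) := by
  have hmin0 : ∀ p, 0 ≤ min (g₁ p) (g₂ p) := fun p => le_min (h.nonneg_left p) (h.nonneg_right p)
  refine continuousOn_moment_of_mass_eq isCompact_Icc (m := fun p => min (g₁ p) (g₂ p)) hw hC
    (fun θ hθ => h.isProfile_mix_Icc hi₁ hi₂ hθ)
    (fun p => (continuous_mix p).continuousOn) ?_ ?_ hmin0 (fun θ hθ p => min_le_mix hθ p) hT hTM
  · filter_upwards [h.pos_left, h.pos_right] with p h1 h2 using lt_min h1 h2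
  · refine (hi₁.add hi₂).mono'
      (h.measurable_left.min h.measurable_right).inv.aestronglyMeasurable (ae_of_all _ fun p => ?_)
    rw [Real.norm_of_nonneg (inv_nonneg.2 (hmin0 p)), Pi.add_apply]
    have e1 := inv_nonneg.2 (h.nonneg_left p)
    have e2 := inv_nonneg.2 (h.nonneg_right p)
    rcases min_choice (g₁ p) (g₂ p) with h' | h' <;> rw [h'] <;> linarith

/-- If `1 / g₁` is not integrable, the mass blows up near `θ = 0`. -/
lemma eventually_lt_integral_planck_mix (h : IsComplementary v g₁ g₂ κ) [IsFiniteMeasure v]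
    (hinf : ∫⁻ p, (ENNReal.ofReal (g₁ p))⁻¹ ∂v = ∞) {R : ℝ} (hR : 0 < R) (M : ℝ) :
    ∀ᶠ θ in 𝓝[>] 0, M < ∫ p, planck (R * mix g₁ g₂ θ p) ∂v := by
  -- Otherwise the mass stays at most `M` along a sequence `θ → 0`, and Fatou's lemma bounds `∫
  -- planck (R g₁)` by `M`. As `R g₁ ≤ R`, this integrand is at least a constant multiple of `1 /
  -- g₁`, a contradiction.
  by_contra hcon
  rw [not_eventually] at hcon
  have hcon' := hcon.and_eventually (Ioo_mem_nhdsGT (zero_lt_one' ℝ))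
  obtain ⟨u, hu, hu'⟩ := exists_seq_forall_of_frequently hcon'
  have hu0 : Tendsto u atTop (𝓝 0) := hu.mono_right nhdsWithin_le_nhds
  have hlim : ∀ᵐ p ∂v, ENNReal.ofReal (planck (R * g₁ p)) ≤
      liminf (fun n => ENNReal.ofReal (planck (R * mix g₁ g₂ (u n) p))) atTop := by
    filter_upwards [h.pos_left] with p hp
    have e1 : Tendsto (fun n => R * mix g₁ g₂ (u n) p) atTop (𝓝 (R * g₁ p)) := by
      have := ((continuous_mix (g₁ := g₁) (g₂ := g₂) p).tendsto 0).comp hu0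
      rw [mix_zero] at this
      exact this.const_mul R
    exact (ENNReal.tendsto_ofReal
      ((continuousAt_planck (mul_pos hR hp)).tendsto.comp e1)).liminf_eq.ge
  have hmeas : ∀ f : X → ℝ, Measurable f → Measurable fun p => ENNReal.ofReal (planck (R * f p)) :=
    fun f hf => by fun_prop
  have hbound : ∫⁻ p, ENNReal.ofReal (planck (R * g₁ p)) ∂v ≤ ENNReal.ofReal M := by
    refine (lintegral_mono_ae hlim).trans ((lintegral_liminf_le fun n =>
      hmeas _ (h.measurable_mix _)).trans ?_)
    refine liminf_le_of_le (by isBoundedDefault) fun b hb => ?_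
    obtain ⟨n, hn⟩ := hb.exists
    refine hn.trans ?_
    have hprof := h.isProfile_mix (hu' n).2
    rw [← ofReal_integral_eq_lintegral_ofReal (hprof.integrable_planck hR)
      (hprof.pos.mono fun p hp => (planck_pos (mul_pos hR hp)).le)]
    exact ENNReal.ofReal_le_ofReal (not_lt.1 (hu' n).1)
  have hle : ∀ᵐ p ∂v, (ENNReal.ofReal (g₁ p))⁻¹ ≤
      ENNReal.ofReal (Real.exp R * R) * ENNReal.ofReal (planck (R * g₁ p)) := by
    filter_upwards [h.pos_left] with p hp
    rw [← ENNReal.ofReal_inv_of_pos hp, ← ENNReal.ofReal_mul (by positivity)]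
    refine ENNReal.ofReal_le_ofReal ?_
    have e1 := exp_neg_mul_inv_le_planck (mul_pos hR hp)
    have e2 : Real.exp (-R) ≤ Real.exp (-(R * g₁ p)) :=
      Real.exp_le_exp.2 (neg_le_neg (mul_le_of_le_one_right hR.le (h.le_one_left p)))
    calc (g₁ p)⁻¹ = Real.exp R * R * (Real.exp (-R) * (R * g₁ p)⁻¹) := by
          rw [Real.exp_neg]; field_simp
      _ ≤ Real.exp R * R * (Real.exp (-(R * g₁ p)) * (R * g₁ p)⁻¹) := by gcongr
      _ ≤ _ := by gcongr
  have := lintegral_mono_ae hle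
  rw [hinf, lintegral_const_mul _ (hmeas _ h.measurable_left), top_le_iff] at this
  exact ENNReal.mul_ne_top ENNReal.ofReal_ne_top (ne_top_of_le_ne_top ENNReal.ofReal_ne_top hbound)
    this

/-- If `1 / g₁` is not integrable, then the distributions of a given mass near `θ = 0` concentrate
where `g₁` vanishes. -/
lemma exists_forall_integral_lt (h : IsComplementary v g₁ g₂ κ) [IsFiniteMeasure v] [NeZero v]
    (hinf : ∫⁻ p, (ENNReal.ofReal (g₁ p))⁻¹ ∂v = ∞) (M : ℝ) {δ : ℝ} (hδ : 0 < δ) :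
    ∃ θ ∈ Ioo (0 : ℝ) (1 / 2), ∀ t, 0 < t → ∫ p, planck (t * mix g₁ g₂ θ p) ∂v = M →
      ∫ p, g₁ p * planck (t * mix g₁ g₂ θ p) ∂v < δ := by
  -- For `θ` near `0` the mass at this `R` exceeds `M`, so mass `M` forces `t > 2 v(X) / δ`. For `θ
  -- < 1 / 2` the mixture is at least `g₁ / 2`, whence `g₁ planck (t mix) ≤ 2 / t`, with integral
  -- below `δ`.
  have hR : 0 < 2 * v.real univ / δ + 1 := by positivity
  obtain ⟨θ, hlt, hθ⟩ := ((h.eventually_lt_integral_planck_mix hinf hR M).and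
    (Ioo_mem_nhdsGT (show (0 : ℝ) < 1 / 2 by norm_num))).exists
  refine ⟨θ, hθ, fun t ht hM => ?_⟩
  have hθ1 : θ < 1 := by linarith [hθ.2]
  have hprof := h.isProfile_mix ⟨hθ.1, hθ1⟩
  have hRt : 2 * v.real univ / δ < t := by
    have hanti := hprof.strictAntiOn_moment (w := fun _ => 1) (C := 1) measurable_const (by simp)
      (ae_of_all _ fun _ => one_pos)
    have : moment v (mix g₁ g₂ θ) (fun _ => 1) t <
        moment v (mix g₁ g₂ θ) (fun _ => 1) (2 * v.real univ / δ + 1) := by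
      simpa only [moment, one_mul, hM] using hlt
    linarith [(hanti.lt_iff_gt ht hR).1 this]
  have habs : ∀ p, |g₁ p| ≤ 1 := fun p =>
    (abs_of_nonneg (h.nonneg_left p)).trans_le (h.le_one_left p)
  calc ∫ p, g₁ p * planck (t * mix g₁ g₂ θ p) ∂v ≤ ∫ _, 2 / t ∂v := by
        refine integral_mono_ae (hprof.integrable_moment h.measurable_left habs ht)
          (integrable_const _) ?_
        filter_upwards [h.pos_left, hprof.pos] with p hp hp'
        have e1 : 1 / 2 * g₁ p ≤ mix g₁ g₂ θ p := by
          have e2 := mul_nonneg hθ.1.le (h.nonneg_right p)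
          have e3 := mul_le_mul_of_nonneg_right (show 1 / 2 ≤ 1 - θ by linarith [hθ.2]) hp.le
          simp only [mix]
          linarith
        calc g₁ p * planck (t * mix g₁ g₂ θ p) ≤ g₁ p * (t * mix g₁ g₂ θ p)⁻¹ := by
              gcongr; exact planck_le_inv (mul_pos ht hp')
          _ ≤ g₁ p * (t * (1 / 2 * g₁ p))⁻¹ := by gcongr
          _ = 2 / t := by field_simp
    _ = 2 * v.real univ / t := by rw [integral_const, smul_eq_mul]; ring
    _ < δ := by
      rw [div_lt_iff₀ hδ] at hRt
      rw [div_lt_iff₀ ht]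
      linarith

end IsComplementary

end BoseEinstein

/-! ### Equilibria of a dispersion relation on the torus -/

namespace BoseEinstein

lemma IsComplementary.integrable_inv {X : Type*} [MeasurableSpace X] {v : Measure X}
    {g₁ g₂ : X → ℝ} {κ : ℝ} (h : IsComplementary v g₁ g₂ κ)
    (hfin : ∫⁻ p, (ENNReal.ofReal (g₁ p))⁻¹ ∂v < ∞) :
    Integrable (fun p => (g₁ p)⁻¹) v ∧
      ∫⁻ p, (ENNReal.ofReal (g₁ p))⁻¹ ∂v = ENNReal.ofReal (∫ p, (g₁ p)⁻¹ ∂v) := by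
  have he : ∫⁻ p, (ENNReal.ofReal (g₁ p))⁻¹ ∂v = ∫⁻ p, ENNReal.ofReal (g₁ p)⁻¹ ∂v :=
    lintegral_congr_ae (h.pos_left.mono fun p hp => (ENNReal.ofReal_inv_of_pos hp).symm)
  have h0 : 0 ≤ᵐ[v] fun p => (g₁ p)⁻¹ := ae_of_all _ fun p => inv_nonneg.2 (h.nonneg_left p)
  have hint : Integrable (fun p => (g₁ p)⁻¹) v :=
    ⟨h.measurable_left.inv.aestronglyMeasurable, by
      rw [hasFiniteIntegral_iff_ofReal h0, ← he]; exact hfin⟩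
  exact ⟨hint, he.trans (ofReal_integral_eq_lintegral_ofReal hint h0).symm⟩

lemma measureReal_torus (d : ℕ) : (volume : Measure (Torus d)).real univ = (2 * π) ^ d := by
  rw [Measure.real, volume_pi, Measure.pi_univ]
  simp [AddCircle.measure_univ, Real.pi_nonneg]

instance neZero_volume_torus (d : ℕ) : NeZero (volume : Measure (Torus d)) :=
  ⟨fun h => by
    have h1 := measureReal_torus d
    rw [h] at h1
    have : 0 < (2 * π) ^ d := by positivity
    simp [Measure.real] at h1
    linarith⟩

/-- A continuous function on the torus with minimum `a ≥ 0` and maximum `1`, both attained on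
null sets only. -/
structure IsDispersion {d : ℕ} (ω : Torus d → ℝ) (a : ℝ) : Prop where
  continuous : Continuous ω
  nonneg : 0 ≤ a
  isLeast : IsLeast (Set.range ω) a
  isGreatest : IsGreatest (Set.range ω) 1
  volume_min : volume {p | ω p = a} = 0
  volume_max : volume {p | ω p = 1} = 0

variable {d : ℕ} {ω : Torus d → ℝ} {a μ ν μ' ν' t : ℝ}

lemma B_eq_planck (ω : Torus d → ℝ) (μ ν : ℝ) (p : Torus d) :
    B ω μ ν p = planck (μ * ω p + ν) := rfl

namespace IsDispersion

lemma le_apply (h : IsDispersion ω a) (p : Torus d) : a ≤ ω p := h.isLeast.2 (mem_range_self p)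

lemma apply_le_one (h : IsDispersion ω a) (p : Torus d) : ω p ≤ 1 :=
  h.isGreatest.2 (mem_range_self p)

lemma ae_lt (h : IsDispersion ω a) : ∀ᵐ p, a < ω p := by
  filter_upwards [measure_eq_zero_iff_ae_notMem.1 h.volume_min] with p hp
  exact (h.le_apply p).lt_of_ne' hp

lemma ae_lt_one (h : IsDispersion ω a) : ∀ᵐ p, ω p < 1 := by
  filter_upwards [measure_eq_zero_iff_ae_notMem.1 h.volume_max] with p hp
  exact (h.apply_le_one p).lt_of_ne hp

lemma lt_one (h : IsDispersion ω a) : a < 1 := by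
  obtain ⟨p, h1, h2⟩ := (h.ae_lt.and h.ae_lt_one).exists
  exact h1.trans h2

lemma isComplementary (h : IsDispersion ω a) :
    IsComplementary volume (fun p => 1 - ω p) (fun p => ω p - a) (1 - a) where
  measurable_left := h.continuous.measurable.const_sub 1
  measurable_right := h.continuous.measurable.sub_const a
  pos_left := h.ae_lt_one.mono fun _ hp => sub_pos.2 hp
  pos_right := h.ae_lt.mono fun _ hp => sub_pos.2 hp
  nonneg_left p := sub_nonneg.2 (h.apply_le_one p)
  nonneg_right p := sub_nonneg.2 (h.le_apply p)
  add_eq p := by ring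
  pos := sub_pos.2 h.lt_one
  le_one := sub_le_self 1 h.nonneg

lemma abs_apply_le (h : IsDispersion ω a) (p : Torus d) : |ω p| ≤ 1 :=
  (abs_of_nonneg (h.nonneg.trans (h.le_apply p))).trans_le (h.apply_le_one p)

lemma ae_pos (h : IsDispersion ω a) : ∀ᵐ p, 0 < ω p :=
  h.ae_lt.mono fun _ hp => h.nonneg.trans_lt hp

lemma integrable_energy (h : IsDispersion ω a) {f : Torus d → ℝ} (hf : Integrable f) :
    Integrable fun p => ω p * f p :=
  hf.bdd_mul h.continuous.aestronglyMeasurable (ae_of_all _ h.abs_apply_le)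

lemma nonneg_at_min (h : IsDispersion ω a) (hq : IsEquilibrium ω μ ν) : 0 ≤ μ * a + ν := by
  obtain ⟨p, hp⟩ := h.isLeast.1
  simpa only [hp] using hq.nonneg p

lemma nonneg_at_max (h : IsDispersion ω a) (hq : IsEquilibrium ω μ ν) : 0 ≤ μ + ν := by
  obtain ⟨p, hp⟩ := h.isGreatest.1
  simpa only [hp, mul_one] using hq.nonneg p

/-- An affine function of `ω` that is nonnegative at `a` and at `1` and not identically zero is
positive strictly between, where `ω` lies almost everywhere. -/
lemma ae_exponent_pos (h : IsDispersion ω a) (hq : IsEquilibrium ω μ ν) :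
    ∀ᵐ p, 0 < μ * ω p + ν := by
  have h1 := h.nonneg_at_min hq
  have h2 := h.nonneg_at_max hq
  filter_upwards [h.ae_lt, h.ae_lt_one] with p hp1 hp2
  rcases lt_trichotomy μ 0 with hμ | rfl | hμ
  · nlinarith
  · have : ν ≠ 0 := fun h0 => hq.ne_zero (by rw [h0])
    rw [zero_mul, zero_add] at h1 ⊢
    exact h1.lt_of_ne' this
  · nlinarith

/-- By continuity the equality holds everywhere; the values at a minimum and a maximum point
determine the parameters, since `a ≠ 1`. -/
lemma eq_of_ae_exponent_eq (h : IsDispersion ω a)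
    (he : ∀ᵐ p, μ * ω p + ν = μ' * ω p + ν') : μ = μ' ∧ ν = ν' := by
  have hc := h.continuous
  have heq : (fun p => μ * ω p + ν) = fun p => μ' * ω p + ν' :=
    (Continuous.ae_eq_iff_eq volume (by fun_prop) (by fun_prop)).1 he
  obtain ⟨p, hp⟩ := h.isLeast.1
  obtain ⟨p', hp'⟩ := h.isGreatest.1
  have e1 := congrFun heq p
  have e2 := congrFun heq p'
  simp only [hp, hp'] at e1 e2
  have e3 : (μ - μ') * (1 - a) = 0 := by linear_combination e2 - e1
  have e4 : μ = μ' := by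
    rcases mul_eq_zero.1 e3 with h0 | h0
    · linarith
    · linarith [h.lt_one]
  exact ⟨e4, by rw [e4] at e2; linarith⟩

/-- Monotonicity of the map from parameters to moments. -/
lemma moments_monotone (h : IsDispersion ω a) (hq : IsEquilibrium ω μ ν)
    (hq' : IsEquilibrium ω μ' ν') :
    0 ≤ (μ - μ') * (energy ω (B ω μ' ν') - energy ω (B ω μ ν)) +
        (ν - ν') * (mass (B ω μ' ν') - mass (B ω μ ν)) ∧
    ((μ - μ') * (energy ω (B ω μ' ν') - energy ω (B ω μ ν)) +
        (ν - ν') * (mass (B ω μ' ν') - mass (B ω μ ν)) = 0 → μ = μ' ∧ ν = ν') := by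
  have i1 := hq.integrable
  have i1' := hq'.integrable
  have i2 := h.integrable_energy i1
  have i2' := h.integrable_energy i1'
  have j2 : Integrable fun p => (μ - μ') * (ω p * B ω μ' ν' p - ω p * B ω μ ν p) :=
    (i2'.sub i2).const_mul (μ - μ')
  have j1 : Integrable fun p => (ν - ν') * (B ω μ' ν' p - B ω μ ν p) :=
    (i1'.sub i1).const_mul (ν - ν')
  have hi := j2.add j1
  have hint : (μ - μ') * (energy ω (B ω μ' ν') - energy ω (B ω μ ν)) +
        (ν - ν') * (mass (B ω μ' ν') - mass (B ω μ ν)) =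
      ∫ p, ((μ - μ') * (ω p * B ω μ' ν' p - ω p * B ω μ ν p) +
        (ν - ν') * (B ω μ' ν' p - B ω μ ν p)) := by
    rw [integral_add j2 j1, integral_const_mul,
      integral_const_mul, integral_sub i2' i2, integral_sub i1' i1]
    rfl
  have hfac : ∀ p, (μ - μ') * (ω p * B ω μ' ν' p - ω p * B ω μ ν p) +
        (ν - ν') * (B ω μ' ν' p - B ω μ ν p) =
      ((μ * ω p + ν) - (μ' * ω p + ν')) *
        (planck (μ' * ω p + ν') - planck (μ * ω p + ν)) := fun p => by
    rw [B_eq_planck, B_eq_planck]; ring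
  have hnn : 0 ≤ᵐ[volume] fun p => (μ - μ') * (ω p * B ω μ' ν' p - ω p * B ω μ ν p) +
        (ν - ν') * (B ω μ' ν' p - B ω μ ν p) := by
    filter_upwards [h.ae_exponent_pos hq, h.ae_exponent_pos hq'] with p h1 h2
    rw [hfac, Pi.zero_apply]
    rcases le_total (μ * ω p + ν) (μ' * ω p + ν') with hle | hle
    · exact mul_nonneg_of_nonpos_of_nonpos (sub_nonpos.2 hle)
        (sub_nonpos.2 (strictAntiOn_planck.antitoneOn h1 h2 hle))
    · exact mul_nonneg (sub_nonneg.2 hle)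
        (sub_nonneg.2 (strictAntiOn_planck.antitoneOn h2 h1 hle))
  rw [hint]
  refine ⟨integral_nonneg_of_ae hnn, fun h0 => ?_⟩
  rw [integral_eq_zero_iff_of_nonneg_ae hnn hi] at h0
  refine h.eq_of_ae_exponent_eq ?_
  filter_upwards [h.ae_exponent_pos hq, h.ae_exponent_pos hq', h0] with p h1 h2 h3
  rw [hfac, Pi.zero_apply] at h3
  rcases mul_eq_zero.1 h3 with h4 | h4
  · exact sub_eq_zero.1 h4
  · exact (strictAntiOn_planck.injOn h2 h1 (sub_eq_zero.1 h4)).symm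

lemma equilibria_subsingleton (h : IsDispersion ω a) (M E : ℝ) :
    (equilibria ω M E).Subsingleton := by
  rintro ⟨μ, ν⟩ ⟨hq, hM, hE⟩ ⟨μ', ν'⟩ ⟨hq', hM', hE'⟩
  simp only at hq hM hE hq' hM' hE'
  obtain ⟨h1, h2⟩ := (h.moments_monotone hq hq').2 (by rw [hM, hM', hE, hE']; ring)
  rw [h1, h2]

/-- Ordered functions with equal integrals agree almost everywhere. This settles the range of `μ`
where `moments_monotone` yields the wrong sign. -/
lemma eq_of_exponent_le (h : IsDispersion ω a) (hq : IsEquilibrium ω μ ν)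
    (hq' : IsEquilibrium ω μ' ν') (hle : ∀ p, μ' * ω p + ν' ≤ μ * ω p + ν)
    (hM : mass (B ω μ ν) = mass (B ω μ' ν')) : μ = μ' ∧ ν = ν' := by
  have hBle : B ω μ ν ≤ᵐ[volume] B ω μ' ν' := by
    filter_upwards [h.ae_exponent_pos hq, h.ae_exponent_pos hq'] with p h1 h2
    exact strictAntiOn_planck.antitoneOn h2 h1 (hle p)
  have heq := (integral_eq_iff_of_ae_le hq.integrable hq'.integrable hBle).1 hM
  refine h.eq_of_ae_exponent_eq ?_
  filter_upwards [h.ae_exponent_pos hq, h.ae_exponent_pos hq', heq] with p h1 h2 h3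
  exact strictAntiOn_planck.injOn h1 h2 h3

/-- Among the equilibria of a given mass, the one with parameters `(-t, t)` has maximal energy. -/
lemma energy_le_of_mass_eq (h : IsDispersion ω a) (hq : IsEquilibrium ω μ ν)
    (hq' : IsEquilibrium ω (-t) t) (hM : mass (B ω μ ν) = mass (B ω (-t) t)) :
    energy ω (B ω μ ν) ≤ energy ω (B ω (-t) t) := by
  -- If `μ ≤ -t`, then `μ ω + ν - t (1 - ω) = (μ + ν) - (μ + t) (1 - ω) ≥ 0`, so the exponents are
  -- ordered. Otherwise monotonicity at equal mass gives the sign of the energy difference.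
  rcases le_or_gt μ (-t) with hle | hlt
  · obtain ⟨h1, h2⟩ := h.eq_of_exponent_le hq hq' (fun p => by
      nlinarith [h.nonneg_at_max hq, h.apply_le_one p]) hM
    rw [h1, h2]
  · have := (h.moments_monotone hq hq').1
    rw [hM, sub_self, mul_zero, add_zero] at this
    exact sub_nonneg.1 (nonneg_of_mul_nonneg_right this (by linarith))

/-- Among the equilibria of a given mass, the one with parameters `(t, -a t)` has minimal
energy. -/
lemma le_energy_of_mass_eq (h : IsDispersion ω a) (hq : IsEquilibrium ω μ ν)
    (hq' : IsEquilibrium ω t (-a * t)) (hM : mass (B ω μ ν) = mass (B ω t (-a * t))) :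
    energy ω (B ω t (-a * t)) ≤ energy ω (B ω μ ν) := by
  -- If `t ≤ μ`, then `μ ω + ν - t (ω - a) = (μ a + ν) + (μ - t) (ω - a) ≥ 0`.
  rcases le_or_gt t μ with hle | hlt
  · obtain ⟨h1, h2⟩ := h.eq_of_exponent_le hq hq' (fun p => by
      nlinarith [h.nonneg_at_min hq, h.le_apply p]) hM
    rw [h1, h2]
  · have := (h.moments_monotone hq hq').1
    rw [hM, sub_self, mul_zero, add_zero] at this
    nlinarith

/-- The exponent is `t (1 - θ) (1 - a)` where `ω = a` and `t θ (1 - a)` where `ω = 1`: `t` measures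
the sum of the two end values, `θ` their proportion. -/
lemma exponent_eq_mix (t θ : ℝ) (p : Torus d) :
    t * (2 * θ - 1) * ω p + t * (1 - θ - θ * a) =
      t * mix (fun p => 1 - ω p) (fun p => ω p - a) θ p := by
  simp only [mix]; ring

lemma B_eq_mix (t θ : ℝ) :
    B ω (t * (2 * θ - 1)) (t * (1 - θ - θ * a)) =
      fun p => planck (t * mix (fun p => 1 - ω p) (fun p => ω p - a) θ p) := by
  ext p
  rw [B_eq_planck, exponent_eq_mix]

lemma isEquilibrium_mix (h : IsDispersion ω a) {θ : ℝ} (hθ : θ ∈ Icc (0 : ℝ) 1) (ht : 0 < t)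
    (hprof : IsProfile volume (mix (fun p => 1 - ω p) (fun p => ω p - a) θ)) :
    IsEquilibrium ω (t * (2 * θ - 1)) (t * (1 - θ - θ * a)) := by
  refine ⟨fun h0 => ?_, fun p => ?_, ?_⟩
  · obtain ⟨h1, h2⟩ := Prod.mk.inj h0
    have h1' := (mul_eq_zero.1 h1).resolve_left ht.ne'
    have h2' := (mul_eq_zero.1 h2).resolve_left ht.ne'
    have : θ = 1 / 2 := by linarith
    rw [this] at h2'
    linarith [h.lt_one]
  · rw [exponent_eq_mix]
    exact mul_nonneg ht.le ((le_min (h.isComplementary.nonneg_left p)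
      (h.isComplementary.nonneg_right p)).trans (min_le_mix (g₁ := fun p => 1 - ω p) (g₂ := fun p => ω p - a) hθ p))
  · rw [B_eq_mix]
    exact hprof.integrable_planck ht

lemma isEquilibrium_plus (h : IsDispersion ω a) (hprof : IsProfile volume fun p => 1 - ω p)
    (ht : 0 < t) : IsEquilibrium ω (-t) t := by
  have := h.isEquilibrium_mix (left_mem_Icc.2 zero_le_one) ht (by rwa [mix_zero])
  simpa using this

lemma isEquilibrium_minus (h : IsDispersion ω a) (hprof : IsProfile volume fun p => ω p - a)
    (ht : 0 < t) : IsEquilibrium ω t (-a * t) := by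
  have := h.isEquilibrium_mix (right_mem_Icc.2 zero_le_one) ht (by rwa [mix_one])
  convert this using 1 <;> ring

lemma integral_one_sub_mul (h : IsDispersion ω a) {f : Torus d → ℝ} (hf : Integrable f) :
    ∫ p, (1 - ω p) * f p = mass f - energy ω f := by
  rw [mass, energy, ← integral_sub hf (h.integrable_energy hf)]
  exact integral_congr_ae (ae_of_all _ fun p => by ring)

lemma integral_sub_mul (h : IsDispersion ω a) {f : Torus d → ℝ} (hf : Integrable f) :
    ∫ p, (ω p - a) * f p = energy ω f - a * mass f := by
  rw [mass, energy, ← integral_const_mul,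
    ← integral_sub (h.integrable_energy hf) (hf.const_mul a)]
  exact integral_congr_ae (ae_of_all _ fun p => by ring)

/-- Existence of equilibria when neither boundary curve is integrable. -/
lemma exists_equilibrium_of_infinite (h : IsDispersion ω a) (hl : lowerIntegral ω a = ∞)
    (hu : upperIntegral ω = ∞) {M E : ℝ} (h1 : a * M < E) (h2 : E < M) :
    (equilibria ω M E).Nonempty := by
  have hc := h.isComplementary
  have hM : 0 < M := by nlinarith [h.lt_one]
  have hex : ∀ θ, θ ∈ Ioo (0 : ℝ) 1 → ∃ t, 0 < t ∧
      ∫ p, planck (t * mix (fun p => 1 - ω p) (fun p => ω p - a) θ p) = M := fun θ hθ =>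
    (hc.isProfile_mix hθ).exists_integral_planck_eq hM
  choose! T hT hTM using hex
  -- The tolerances `M - E` and `E - a M` put the energy above `E` at `θ₁` and below `E` at `1 -
  -- θ₂`; both `θ₁` and `θ₂` are below `1 / 2`, so the interval is not reversed.
  obtain ⟨θ₁, hθ₁, hlt₁⟩ := hc.exists_forall_integral_lt hu M (sub_pos.2 h2)
  obtain ⟨θ₂, hθ₂, hlt₂⟩ := hc.symm.exists_forall_integral_lt hl M (sub_pos.2 h1)
  have hi₁ : θ₁ ∈ Ioo (0 : ℝ) 1 := ⟨hθ₁.1, by linarith [hθ₁.2]⟩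
  have hi₂ : 1 - θ₂ ∈ Ioo (0 : ℝ) 1 := ⟨by linarith [hθ₂.2], by linarith [hθ₂.1]⟩
  have hsub : ∀ θ ∈ Icc θ₁ (1 - θ₂), θ ∈ Ioo (0 : ℝ) 1 := fun θ hθ =>
    ⟨hi₁.1.trans_le hθ.1, hθ.2.trans_lt hi₂.2⟩
  have e1 := hlt₁ _ (hT _ hi₁) (hTM _ hi₁)
  rw [h.integral_one_sub_mul ((hc.isProfile_mix hi₁).integrable_planck (hT _ hi₁)), mass,
    hTM _ hi₁] at e1
  have e2 := hlt₂ (T (1 - θ₂)) (hT _ hi₂) (by rw [mix_comm]; exact hTM _ hi₂)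
  rw [mix_comm, h.integral_sub_mul ((hc.isProfile_mix hi₂).integrable_planck (hT _ hi₂)), mass,
    hTM _ hi₂] at e2
  obtain ⟨θ, hθ, he⟩ := intermediate_value_Icc' (show θ₁ ≤ 1 - θ₂ by linarith [hθ₁.2, hθ₂.2])
    (hc.continuousOn_moment_Ioo h.continuous.measurable h.abs_apply_le hi₁.1 hi₂.2
      (fun θ hθ => hT θ (hsub θ hθ)) (fun θ hθ => hTM θ (hsub θ hθ)))
    (show E ∈ Icc _ _ from ⟨by simp only [energy] at e2; linarith,
      by simp only [energy] at e1; linarith⟩)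
  have hi := hsub θ hθ
  refine ⟨(T θ * (2 * θ - 1), T θ * (1 - θ - θ * a)),
    h.isEquilibrium_mix (Ioo_subset_Icc_self hi) (hT θ hi) (hc.isProfile_mix hi), ?_, ?_⟩
  · rw [B_eq_mix]; exact hTM θ hi
  · rw [B_eq_mix]; exact he

/-- Existence of equilibria between the two boundary curves. -/
lemma exists_equilibrium_of_finite (h : IsDispersion ω a)
    (hi₁ : Integrable fun p => (1 - ω p)⁻¹) (hi₂ : Integrable fun p => (ω p - a)⁻¹) {t₁ t₂ E : ℝ}
    (ht₁ : 0 < t₁) (ht₂ : 0 < t₂) (hmass : mass (B ω t₂ (-a * t₂)) = mass (B ω (-t₁) t₁))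
    (h1 : energy ω (B ω t₂ (-a * t₂)) ≤ E) (h2 : E ≤ energy ω (B ω (-t₁) t₁)) :
    (equilibria ω (mass (B ω (-t₁) t₁)) E).Nonempty := by
  have hc := h.isComplementary
  have hp₁ := hc.isProfile_left hi₁
  have hp₂ := hc.symm.isProfile_left hi₂
  have hprof : ∀ θ ∈ Icc (0 : ℝ) 1, IsProfile volume
      (mix (fun p => 1 - ω p) (fun p => ω p - a) θ) := fun θ hθ => hc.isProfile_mix_Icc hi₁ hi₂ hθ
  have hM : 0 < mass (B ω (-t₁) t₁) := integral_pos_of_ae_pos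
    (h.isEquilibrium_plus hp₁ ht₁).integrable
    ((h.ae_exponent_pos (h.isEquilibrium_plus hp₁ ht₁)).mono fun p hp => planck_pos hp)
  have hex : ∀ θ, θ ∈ Icc (0 : ℝ) 1 → ∃ t, 0 < t ∧
      ∫ p, planck (t * mix (fun p => 1 - ω p) (fun p => ω p - a) θ p) =
        mass (B ω (-t₁) t₁) := fun θ hθ => (hprof θ hθ).exists_integral_planck_eq hM
  choose! T hT hTM using hex
  have hmem : ∀ θ ∈ Icc (0 : ℝ) 1, (T θ * (2 * θ - 1), T θ * (1 - θ - θ * a)) ∈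
      equilibria ω (mass (B ω (-t₁) t₁))
        (∫ p, ω p * planck (T θ * mix (fun p => 1 - ω p) (fun p => ω p - a) θ p)) := by
    intro θ hθ
    refine ⟨h.isEquilibrium_mix hθ (hT θ hθ) (hprof θ hθ), ?_, ?_⟩
    · rw [B_eq_mix]; exact hTM θ hθ
    · rw [B_eq_mix]; rfl
  have hz := left_mem_Icc.2 (zero_le_one' ℝ)
  have ho := right_mem_Icc.2 (zero_le_one' ℝ)
  obtain ⟨hq₁, hM₁, hE₁⟩ := hmem 0 hz
  obtain ⟨hq₂, hM₂, hE₂⟩ := hmem 1 ho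
  -- Extremality at equal mass compares the ends of the family with the given boundary equilibria,
  -- so `T 0 = t₁` and `T 1 = t₂` need not be shown.
  have e1 : E ≤ _ := h2.trans (?_ : _ ≤ ∫ p, ω p *
    planck (T 0 * mix (fun p => 1 - ω p) (fun p => ω p - a) 0 p))
  have e2 : _ ≤ E := (?_ : ∫ p, ω p *
    planck (T 1 * mix (fun p => 1 - ω p) (fun p => ω p - a) 1 p) ≤ _).trans h1
  · obtain ⟨θ, hθ, he⟩ := intermediate_value_Icc' (zero_le_one' ℝ)
      (hc.continuousOn_moment_Icc h.continuous.measurable h.abs_apply_le hi₁ hi₂ hT hTM) ⟨e2, e1⟩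
    have := hmem θ hθ
    simp only at he
    rw [he] at this
    exact ⟨_, this⟩
  · rw [← hE₂]
    have e3 : T 1 * (2 * 1 - 1) = T 1 := by ring
    have e4 : T 1 * (1 - 1 - 1 * a) = -a * T 1 := by ring
    simp only [e3, e4] at hq₂ hM₂ ⊢
    exact h.le_energy_of_mass_eq (h.isEquilibrium_minus hp₂ ht₂) hq₂ (by rw [hM₂, hmass])
  · rw [← hE₁]
    have e3 : T 0 * (2 * 0 - 1) = -T 0 := by ring
    have e4 : T 0 * (1 - 0 - 0 * a) = T 0 := by ring
    simp only [e3, e4] at hq₁ hM₁ ⊢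
    exact h.energy_le_of_mass_eq (h.isEquilibrium_plus hp₁ ht₁) hq₁ hM₁.symm

lemma exists_graph_plus (h : IsDispersion ω a) (hu : upperIntegral ω < ∞) :
    ∃ f : ℝ → ℝ, curvePlus ω = graphPos f ∧ DifferentiableOn ℝ f (Ici 0) ∧
      StrictMonoOn f (Ici 0) ∧ f 0 = 0 ∧
      Tendsto (fun m => f m / m) atTop (𝓝 (beta ω)) := by
  obtain ⟨hi, hI⟩ := h.isComplementary.integrable_inv hu
  have hcurve : curvePlus ω = {x : ℝ × ℝ | ∃ t : ℝ, 0 < t ∧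
      x = (∫ p, planck (t * (1 - ω p)), ∫ p, ω p * planck (t * (1 - ω p)))} := by
    have hB : ∀ t, B ω (-t) t = fun p => planck (t * (1 - ω p)) := fun t => by
      ext p; rw [B_eq_planck]; congr 1; ring
    simp only [curvePlus, hB, mass, energy]
  -- This is the asymptotic slope for the weight `ω = 1 + (-1) (1 - ω)` and the profile `1 - ω`.
  have hbeta : beta ω =
      1 + (-1) * ((volume : Measure (Torus d)).real univ / ∫ p, (1 - ω p)⁻¹) := by
    rw [beta, upperIntegral, hI, ENNReal.toReal_inv, ENNReal.toReal_ofReal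
      (integral_nonneg fun p => inv_nonneg.2 (h.isComplementary.nonneg_left p)),
      measureReal_torus]
    ring
  rw [hcurve, hbeta]
  refine (h.isComplementary.isProfile_left hi).exists_graph h.isComplementary.nonneg_left
    (fun ε hε => ?_) (fun p => by ring) h.ae_pos
  obtain ⟨p, hp⟩ := h.isGreatest.1
  exact (isOpen_lt (by have := h.continuous; fun_prop) continuous_const).measure_pos _
    ⟨p, by simpa [hp] using hε⟩

lemma exists_graph_minus (h : IsDispersion ω a) (hl : lowerIntegral ω a < ∞) :
    ∃ f : ℝ → ℝ, curveMinus ω a = graphPos f ∧ DifferentiableOn ℝ f (Ici 0) ∧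
      StrictMonoOn f (Ici 0) ∧ f 0 = 0 ∧
      Tendsto (fun m => f m / m) atTop (𝓝 (alpha ω a)) := by
  obtain ⟨hi, hI⟩ := h.isComplementary.symm.integrable_inv hl
  have hcurve : curveMinus ω a = {x : ℝ × ℝ | ∃ t : ℝ, 0 < t ∧
      x = (∫ p, planck (t * (ω p - a)), ∫ p, ω p * planck (t * (ω p - a)))} := by
    have hB : ∀ t, B ω t (-a * t) = fun p => planck (t * (ω p - a)) := fun t => by
      ext p; rw [B_eq_planck]; congr 1; ring
    simp only [curveMinus, hB, mass, energy]
  have halpha : alpha ω a =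
      a + 1 * ((volume : Measure (Torus d)).real univ / ∫ p, (ω p - a)⁻¹) := by
    rw [alpha, lowerIntegral, hI, ENNReal.toReal_inv, ENNReal.toReal_ofReal
      (integral_nonneg fun p => inv_nonneg.2 (h.isComplementary.nonneg_right p)),
      measureReal_torus]
    ring
  rw [hcurve, halpha]
  refine (h.isComplementary.symm.isProfile_left hi).exists_graph h.isComplementary.nonneg_right
    (fun ε hε => ?_) (fun p => by ring) h.ae_pos
  obtain ⟨p, hp⟩ := h.isLeast.1
  exact (isOpen_lt (by have := h.continuous; fun_prop) continuous_const).measure_pos _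
    ⟨p, by simpa [hp] using hε⟩

/-- Equilibria exist exactly in the region between the two boundary curves. -/
lemma exists_mem_equilibria_iff (h : IsDispersion ω a)
    (hi₁ : Integrable fun p => (1 - ω p)⁻¹) (hi₂ : Integrable fun p => (ω p - a)⁻¹)
    {fp fm : ℝ → ℝ} (hfp : curvePlus ω = graphPos fp) (hfm : curveMinus ω a = graphPos fm)
    (M E : ℝ) : (∃ q, q ∈ equilibria ω M E) ↔ (M, E) ∈ regionS fm fp := by
  have hp₁ := h.isComplementary.isProfile_left hi₁
  have hp₂ := h.isComplementary.symm.isProfile_left hi₂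
  have hplus : ∀ M, 0 < M → ∃ t, 0 < t ∧ (M, fp M) = (mass (B ω (-t) t), energy ω (B ω (-t) t)) :=
    fun M hM => by
      have : (M, fp M) ∈ curvePlus ω := by rw [hfp]; exact ⟨hM, rfl⟩
      exact this
  have hminus : ∀ M, 0 < M →
      ∃ t, 0 < t ∧ (M, fm M) = (mass (B ω t (-a * t)), energy ω (B ω t (-a * t))) :=
    fun M hM => by
      have : (M, fm M) ∈ curveMinus ω a := by rw [hfm]; exact ⟨hM, rfl⟩
      exact this
  constructor
  · rintro ⟨⟨μ, ν⟩, hq, hM, hE⟩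
    simp only at hq hM hE
    have hM0 : 0 < M := by
      rw [← hM]
      exact integral_pos_of_ae_pos hq.integrable
        ((h.ae_exponent_pos hq).mono fun p hp => planck_pos hp)
    obtain ⟨t₁, ht₁, e₁⟩ := hplus M hM0
    obtain ⟨t₂, ht₂, e₂⟩ := hminus M hM0
    obtain ⟨e₁, e₁'⟩ := Prod.mk.inj e₁
    obtain ⟨e₂, e₂'⟩ := Prod.mk.inj e₂
    refine ⟨hM0, ?_, ?_⟩
    · simp only
      rw [e₂', ← hE]
      exact h.le_energy_of_mass_eq hq (h.isEquilibrium_minus hp₂ ht₂) (hM.trans e₂)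
    · simp only
      rw [e₁', ← hE]
      exact h.energy_le_of_mass_eq hq (h.isEquilibrium_plus hp₁ ht₁) (hM.trans e₁)
  · rintro ⟨hM0, h1, h2⟩
    simp only at hM0 h1 h2
    obtain ⟨t₁, ht₁, e₁⟩ := hplus M hM0
    obtain ⟨t₂, ht₂, e₂⟩ := hminus M hM0
    obtain ⟨e₁, e₁'⟩ := Prod.mk.inj e₁
    obtain ⟨e₂, e₂'⟩ := Prod.mk.inj e₂
    rw [e₁'] at h2
    rw [e₂'] at h1
    have := h.exists_equilibrium_of_finite hi₁ hi₂ ht₁ ht₂ (e₂.symm.trans e₁) h1 h2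
    rwa [← e₁] at this

end IsDispersion

end BoseEinstein

theorem theorem3p1 (d : ℕ) (ω : Torus d → ℝ) (a : ℝ)
    (hω : Continuous ω) (ha : 0 ≤ a)
    (hmin : IsLeast (Set.range ω) a) (hmax : IsGreatest (Set.range ω) 1)
    (hmin_null : volume {p | ω p = a} = 0) (hmax_null : volume {p | ω p = 1} = 0) :
    -- both integrals infinite
    (BoseEinstein.lowerIntegral ω a = ∞ → BoseEinstein.upperIntegral ω = ∞ →
      ∀ M₀ E₀ : ℝ, a * M₀ < E₀ → E₀ < M₀ → ∃! q : ℝ × ℝ, q ∈ BoseEinstein.equilibria ω M₀ E₀) ∧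
    -- both integrals finite
    (BoseEinstein.lowerIntegral ω a < ∞ → BoseEinstein.upperIntegral ω < ∞ →
      (∀ t : ℝ, 0 < t →
        BoseEinstein.IsEquilibrium ω (-t) t ∧ BoseEinstein.IsEquilibrium ω t (-a * t)) ∧
      ∃ fp fm : ℝ → ℝ,
        BoseEinstein.curvePlus ω = BoseEinstein.graphPos fp ∧
        BoseEinstein.curveMinus ω a = BoseEinstein.graphPos fm ∧
        DifferentiableOn ℝ fp (Ici 0) ∧ DifferentiableOn ℝ fm (Ici 0) ∧
        StrictMonoOn fp (Ici 0) ∧ StrictMonoOn fm (Ici 0) ∧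
        fp 0 = 0 ∧ fm 0 = 0 ∧
        Tendsto (fun M => fp M / M) atTop (𝓝 (BoseEinstein.beta ω)) ∧
        Tendsto (fun M => fm M / M) atTop (𝓝 (BoseEinstein.alpha ω a)) ∧
        ∀ M₀ E₀ : ℝ,
          ((∃ q : ℝ × ℝ, q ∈ BoseEinstein.equilibria ω M₀ E₀) ↔
            (M₀, E₀) ∈ BoseEinstein.regionS fm fp) ∧
          ((M₀, E₀) ∈ BoseEinstein.regionS fm fp →
            ∃! q : ℝ × ℝ, q ∈ BoseEinstein.equilibria ω M₀ E₀)) := by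
  have h : BoseEinstein.IsDispersion ω a := ⟨hω, ha, hmin, hmax, hmin_null, hmax_null⟩
  refine ⟨fun hl hu M₀ E₀ h1 h2 => ?_, fun hl hu => ?_⟩
  · obtain ⟨q, hq⟩ := h.exists_equilibrium_of_infinite hl hu h1 h2
    exact ⟨q, hq, fun q' hq' => h.equilibria_subsingleton M₀ E₀ hq' hq⟩
  · have hi₁ := (h.isComplementary.integrable_inv hu).1
    have hi₂ := (h.isComplementary.symm.integrable_inv hl).1
    obtain ⟨fp, hfp, hdp, hsp, hp0, hlp⟩ := h.exists_graph_plus hu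
    obtain ⟨fm, hfm, hdm, hsm, hm0, hlm⟩ := h.exists_graph_minus hl
    have hiff := h.exists_mem_equilibria_iff hi₁ hi₂ hfp hfm
    refine ⟨fun t ht => ⟨h.isEquilibrium_plus (h.isComplementary.isProfile_left hi₁) ht,
      h.isEquilibrium_minus (h.isComplementary.symm.isProfile_left hi₂) ht⟩, fp, fm, hfp, hfm,
      hdp, hdm, hsp, hsm, hp0, hm0, hlp, hlm, fun M₀ E₀ => ⟨hiff M₀ E₀, fun hS => ?_⟩⟩
    obtain ⟨q, hq⟩ := (hiff M₀ E₀).2 hS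
    exact ⟨q, hq, fun q' hq' => h.equilibria_subsingleton M₀ E₀ hq' hq⟩
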